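/- Let $K$ be a field with $2\neq 0$ (for instance $\mathbb R$ or $\mathbb C$) and let $q,a,b,c,d\in K$ with $q,a,b\ne 0$ and $q^m\neq 1$ for all $m\ge 1$. Write $(A;q)_n=\prod_{i=0}^{n-1}(1-Aq^i)$ and $(A_1,\dots,A_r;q)_n=\prod_i(A_i;q)_n$ for $n\ge 0$, and $(A;q)_{-m}=1/(Aq^{-m};q)_m$ for $m>0$ (a factor $(A;q)_{-m}$ in a denominator is read as $(Aq^{-m};q)_m$ in the numerator). Put $x=(z+1/z)/2$, so that $(Az,A/z;q)_n=\prod_{j=0}^{n-1}(1-2Axq^j+A^2q^{2j})$ is a polynomial in $x$. Assume the nondegeneracy conditions $$ac,\ ad,\ cd\notin\{q^{-i}:i\ge 0\},\qquad ab,\ bc,\ bd\notin\{q^{i}:i\ge 1\},\qquad abcd\notin\{q^{1-i}:i\ge 0\}.$$ Let $$d_n(x)=\prod_{j=0}^{n-1}\bigl(1-2bxq^{-1-j}+b^2q^{-2-2j}\bigr)=(bzq^{-n},bq^{-n}/z;q)_n ,\qquad V=\mathrm{span}_K\{x^n/d_m(x):n,m\ge 0\}\subset K(x).$$ There is exactly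 one linear functional $\mathcal L=\mathcal L_{a,b,c,d}$ on $V$ such that for all $j,k,n\ge0$ $$\mathcal L\left(\frac{(cz,c/z;q)_j\,(az,a/z;q)_k}{(bzq^{-n},bq^{-n}/z;q)_n}\right)=\frac{(cd;q)_j\,(ac;q)_{k+j}\,(ad;q)_k}{(abq^{k-n};q)_{n-k}\,(bcq^{j-n};q)_{n-j}\,(bdq^{-n};q)_n\,(abcd;q)_{k+j-n}} .$$ Let $p_n(x;a,b,c,d\,|\,q)=\frac{(ab,ac,ad;q)_n}{a^n}\sum_{k=0}^n\frac{(q^{-n},abcdq^{n-1},az,a/z;q)_k}{(q,ab,ac,ad;q)_k}q^k$ be the Askey–Wilson polynomials, and $$p_n(x):=p_n(x;a,bq^{-n},c,d\,|\,q)=\frac{(abq^{-n},ac,ad;q)_n}{a^n}\sum_{k=0}^n\frac{(q^{-n},abcd/q,az,a/z;q)_k}{(q,ac,ad,abq^{-n};q)_k}\,q^k .$$ Then $p_n(x)$ has degree $n$, and these shifted Askey–Wilson polynomials are, up to constants, the type $R_I$ orthogonal polynomials for $\mathcal L$ and $d_n(x)$, that is: (i) for every $n\ge0$, a polynomial $p(x)$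 of degree at most $n$ satisfies $\mathcal L(x^kp(x)/d_n(x))=0$ for all $0\le k<n$ if and only if it is a constant multiple of $p_n(x)$; (ii) for a sequence of polynomials $(P_n)_{n\ge0}$ the following are equivalent: (A) for each $n$, $P_n$ is the monic multiple of $p_n$; (B) there are constants $\beta_n,\alpha_n,\gamma_n$ with $P_0=1$, $P_1=x-\beta_0$, $P_{n+1}(x)=(x-\beta_n)P_n(x)-(\alpha_nx+\gamma_n)P_{n-1}(x)$ for $n\ge1$, with $\alpha_n\ne0$ and $P_n(-\gamma_n/\alpha_n)\ne0$ for $n\ge1$, such that $\prod_{i=1}^m(\alpha_ix+\gamma_i)$ is a nonzero constant multiple of $d_m(x)$ for every $m\ge0$, and $\mathcal L(1)=1$, $\mathcal L(x^nP_m(x)/d_m(x))=0$ for $0\le n<m$. -/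

import Mathlib

open Polynomial

noncomputable section

namespace AskeyWilsonRI

variable {K : Type*} [Field K]

/-- The `q`-shifted factorial `(A; q)_n = ∏_{i < n} (1 - A q^i)`, for `n ≥ 0`. -/
def qPoch (q A : K) (n : ℕ) : K := ∏ i ∈ Finset.range n, (1 - A * q ^ i)

/-- The `q`-shifted factorial `(A; q)_m` for an integer `m`, with
`(A; q)_{-m} = 1 / (A q^{-m}; q)_m` for `m > 0`. Below it only occurs in denominators, and
`((A; q)_{-m})⁻¹ = (A q^{-m}; q)_m` holds in every case, also where the latter vanishes. -/
def qPochInt (q A : K) : ℤ → K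
  | Int.ofNat m => qPoch q A m
  | Int.negSucc m => (qPoch q (A * q ^ (-((m : ℤ) + 1))) (m + 1))⁻¹

/-- The polynomial `(A z, A / z; q)_n = ∏_{j < n} (1 - 2 A x q^j + A² q^{2j})` in
`x = (z + 1/z)/2`. -/
def pairPoch (q A : K) (n : ℕ) : K[X] :=
  ∏ j ∈ Finset.range n, (1 - C (2 * A * q ^ j) * X + C (A ^ 2 * q ^ (2 * j)))

theorem eval_pairPoch (h2 : (2 : K) ≠ 0) (q A z : K) (hz : z ≠ 0) (n : ℕ) :
    (pairPoch q A n).eval ((z + 1 / z) / 2) = qPoch q (A * z) n * qPoch q (A / z) n := by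
  simp only [pairPoch, qPoch, eval_prod, ← Finset.prod_mul_distrib]
  refine Finset.prod_congr rfl fun j _ => ?_
  simp
  field_simp
  ring

/-- The polynomial in `x = (z + 1/z)/2` given by the terminating basic hypergeometric series
`₄φ₃(q^{-n}, B, a z, a / z; r, s, t; q, q)`. -/
def phi43 (q : K) (n : ℕ) (B a r s t : K) : K[X] :=
  ∑ k ∈ Finset.range (n + 1),
    C (qPoch q (q ^ (-(n : ℤ))) k * qPoch q B k /
        (qPoch q r k * qPoch q s k * qPoch q t k * qPoch q q k) * q ^ k) * pairPoch q a k

/-- The Askey–Wilson polynomial `p_n(x; a, b, c, d | q)`. -/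
def askeyWilson (q a b c d : K) (n : ℕ) : K[X] :=
  C (qPoch q (a * b) n * qPoch q (a * c) n * qPoch q (a * d) n / a ^ n) *
    phi43 q n (a * b * c * d * q ^ ((n : ℤ) - 1)) a (a * b) (a * c) (a * d)

/-- The denominator polynomials
`d_n(x) = ∏_{j < n} (1 - 2 b x q^{-1-j} + b² q^{-2-2j})`. -/
def den (q b : K) (n : ℕ) : K[X] :=
  ∏ j ∈ Finset.range n,
    (1 - C (2 * b * q ^ (-1 - (j : ℤ))) * X + C (b ^ 2 * q ^ (-2 - 2 * (j : ℤ))))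

/-- `d_n(x) = (b z q^{-n}, b q^{-n} / z; q)_n`. -/
theorem den_eq_pairPoch (q b : K) (hq : q ≠ 0) (n : ℕ) :
    den q b n = pairPoch q (b * q ^ (-(n : ℤ))) n := by
  unfold den pairPoch
  rw [← Finset.prod_range_reflect]
  refine Finset.prod_congr rfl fun j hj => ?_
  have hj' : j + 1 ≤ n := Finset.mem_range.1 hj
  have h0 : ((n - 1 - j : ℕ) : ℤ) = (n : ℤ) - 1 - j := by omega
  have h1 : q ^ (-1 - ((n - 1 - j : ℕ) : ℤ)) = q ^ (-(n : ℤ)) * q ^ j := by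
    rw [h0, ← zpow_natCast q j, ← zpow_add₀ hq]
    congr 1
    ring
  have h2 : q ^ (-2 - 2 * ((n - 1 - j : ℕ) : ℤ)) = (q ^ (-(n : ℤ)) * q ^ j) ^ 2 := by
    rw [← h1, ← zpow_natCast, ← zpow_mul]
    congr 1
    push_cast
    ring
  rw [h1, h2]
  congr 2 <;> ring_nf

/-- The space `V = span {x^n / d_m(x) : n, m ≥ 0}` of rational functions. -/
def ratSpace (d : ℕ → K[X]) : Submodule K (RatFunc K) :=
  Submodule.span K {f | ∃ n m : ℕ,
    f = algebraMap K[X] (RatFunc K) (X ^ n) / algebraMap K[X] (RatFunc K) (d m)}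

theorem div_mem_ratSpace (d : ℕ → K[X]) (p : K[X]) (m : ℕ) :
    algebraMap K[X] (RatFunc K) p / algebraMap K[X] (RatFunc K) (d m) ∈ ratSpace d := by
  induction p using Polynomial.induction_on' with
  | add p r hp hr =>
    rw [map_add, add_div]
    exact Submodule.add_mem _ hp hr
  | monomial n c =>
    have h : algebraMap K[X] (RatFunc K) (monomial n c) / algebraMap K[X] (RatFunc K) (d m)
        = c • (algebraMap K[X] (RatFunc K) (X ^ n) / algebraMap K[X] (RatFunc K) (d m)) := by
      rw [← smul_X_eq_monomial, Algebra.algebraMap_eq_smul_one (c • X ^ n), smul_assoc,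
        ← Algebra.algebraMap_eq_smul_one, smul_div_assoc]
    rw [h]
    exact Submodule.smul_mem _ _ (Submodule.subset_span ⟨n, m, rfl⟩)

/-- The element `p(x) / d_m(x)` of `V`. -/
def frac (d : ℕ → K[X]) (p : K[X]) (m : ℕ) : ratSpace d :=
  ⟨algebraMap K[X] (RatFunc K) p / algebraMap K[X] (RatFunc K) (d m), div_mem_ratSpace d p m⟩

/-- `L` is the Askey–Wilson functional `L_{a,b,c,d}` on `V`: its value on
`(c z, c/z; q)_j (a z, a/z; q)_k / (b z q^{-n}, b q^{-n}/z; q)_n` is the stated product, for all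
`j, k, n ≥ 0`. The denominator is `d_n(x)`, see `den_eq_pairPoch`. -/
def IsAskeyWilsonFunctional (q a b c d : K) (L : ratSpace (den q b) →ₗ[K] K) : Prop :=
  ∀ j k n : ℕ,
    L (frac (den q b) (pairPoch q c j * pairPoch q a k) n) =
      qPoch q (c * d) j * qPoch q (a * c) (k + j) * qPoch q (a * d) k /
        (qPochInt q (a * b * q ^ ((k : ℤ) - n)) ((n : ℤ) - k) *
          qPochInt q (b * c * q ^ ((j : ℤ) - n)) ((n : ℤ) - j) *
          qPoch q (b * d * q ^ (-(n : ℤ))) n *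
          qPochInt q (a * b * c * d) ((k : ℤ) + j - n))

/-- `P` is the sequence of (monic) type `R_I` orthogonal polynomials for the functional `L` and
the denominator polynomials `d`: it satisfies a recurrence
`P_{n+1} = (x - β_n) P_n - (α_n x + γ_n) P_{n-1}` with `P_{-1} = 0`, `P_0 = 1`, whose coefficients
fulfil `α_n ≠ 0` and `P_n(-γ_n / α_n) ≠ 0`, where `∏_{1 ≤ i ≤ m} (α_i x + γ_i)` is a nonzero
constant multiple of `d_m`, and `L(1) = 1` (with `1 = d_0 / d_0`), `L(x^n P_m / d_m) = 0` for
`0 ≤ n < m`. -/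
def IsTypeRI (d : ℕ → K[X]) (L : ratSpace d →ₗ[K] K) (P : ℕ → K[X]) : Prop :=
  (∃ β α γ : ℕ → K,
    P 0 = 1 ∧
    P 1 = X - C (β 0) ∧
    (∀ n, 1 ≤ n →
      P (n + 1) = (X - C (β n)) * P n - (C (α n) * X + C (γ n)) * P (n - 1)) ∧
    (∀ n, 1 ≤ n → α n ≠ 0 ∧ (P n).eval (-γ n / α n) ≠ 0) ∧
    (∀ m, ∃ κ : K, κ ≠ 0 ∧
      ∏ i ∈ Finset.Icc 1 m, (C (α i) * X + C (γ i)) = C κ * d m)) ∧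
  L (frac d (d 0) 0) = 1 ∧
  ∀ n m : ℕ, n < m → L (frac d (X ^ n * P m) m) = 0

end AskeyWilsonRI

end

open Polynomial

noncomputable section

namespace AskeyWilsonRI

variable {K : Type*} [Field K]

/-! Write `Λ m` for the functional `p ↦ L (p / d_m)` and `e_m = d_{m+1} / d_m`, a linear polynomial.
Everything about type `R_I` orthogonality follows from three facts on the scalars `L (p_n / d_m)`:
they vanish for `1 ≤ m ≤ n` and do not vanish for `m = 0` and `m = n + 1`. This is
`BiorthogonalData`. Division by `e_{m-1}` lowers the level `m` together with the degree of the test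
polynomial, so the vanishing gives orthogonality, the value at `m = 0` gives nonzero norms, and the
value at `m = n + 1` gives uniqueness (`orthogonal_iff`). The recurrence and the nonvanishing at the
roots of `e_n` follow from uniqueness.

The three facts come from q-series (`biorthogonalData`). Applying `L` termwise gives a nonzero
multiple of `∑ w_k R(q^k)`, where the weights `w_k = (q^{-n};q)_k q^k / (q;q)_k` are, up to a
factor, the Lagrange weights at `1, q, …, q^n`. The sum is thus a divided difference of order `n`.
For `1 ≤ m ≤ n`, `R` is a polynomial of degree less than `n`, and the sum is zero. For `m = 0` and
`m = n + 1`, `R` is a polynomial `f` of degree at most `n` over a linear factor; the sum is then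
essentially the value of `f` at the pole, nonzero because `cd q^i ≠ 1`.

Existence of `L`: the values with `j = 0` define each `Λ m` on the basis `(az, a/z; q)_k`. The
linear relation `pairFactor_eq` turns compatibility in `m` and the values for all `j` into
contiguous relations between moments, and compatible `Λ m` glue to a functional on `V`. -/

/-! ### Orthogonality along a chain of denominators -/

/-- Division with remainder by a polynomial of degree one. -/
theorem exists_eq_mul_add_C {e : K[X]} (he : e.degree = 1) (f : K[X]) :
    ∃ (g : K[X]) (r : K), f = g * e + C r ∧ (g ≠ 0 → f.degree = g.degree + 1) := by
  have he0 : e ≠ 0 := by rintro rfl; simp at he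
  have hr : (f % e).degree < 1 := he ▸ EuclideanDomain.mod_lt f he0
  have hr' : f % e = C ((f % e).coeff 0) := by
    apply eq_C_of_degree_le_zero
    by_contra! h0
    have h1 := degree_eq_natDegree (ne_zero_of_degree_gt h0)
    rw [h1] at h0 hr
    norm_cast at h0 hr
    omega
  refine ⟨f / e, (f % e).coeff 0, ?_, ?_⟩
  · rw [← hr', mul_comm, EuclideanDomain.div_add_mod]
  · have hf : f = f / e * e + f % e := by rw [mul_comm, EuclideanDomain.div_add_mod]
    intro h
    conv_lhs => rw [hf]
    rw [degree_add_eq_left_of_degree_lt, degree_mul, he]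
    rw [degree_mul, he]
    refine hr.trans_le ?_
    rw [degree_eq_natDegree h]
    exact_mod_cast Nat.le_add_left _ _

/-- The data of a family of functionals `Λ m` on polynomials, thought of as `p ↦ L (p / d_m)` with
`d_m = ∏_{j < m} e_j`, and of polynomials `p n` of degree `n` such that `L (p_n / d_m)` vanishes
for `1 ≤ m ≤ n` but not for `m = 0` and `m = n + 1`. -/
structure BiorthogonalData (Λ : ℕ → K[X] →ₗ[K] K) (e p : ℕ → K[X]) : Prop where
  degree_e : ∀ n, (e n).degree = 1
  degree_p : ∀ n, (p n).degree = n
  map_mul_e : ∀ n f, Λ (n + 1) (f * e n) = Λ n f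
  map_eq_zero : ∀ n m, 1 ≤ m → m ≤ n → Λ m (p n) = 0
  map_zero_ne : ∀ n, Λ 0 (p n) ≠ 0
  map_succ_ne : ∀ n, Λ (n + 1) (p n) ≠ 0

namespace BiorthogonalData

variable {Λ : ℕ → K[X] →ₗ[K] K} {e p : ℕ → K[X]}

theorem map_C_mul (Λ : K[X] →ₗ[K] K) (r : K) (f : K[X]) : Λ (C r * f) = r * Λ f := by
  rw [← smul_eq_C_mul, map_smul, smul_eq_mul]

theorem p_ne_zero (h : BiorthogonalData Λ e p) (n : ℕ) : p n ≠ 0 := by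
  intro h0
  have := h.degree_p n
  simp [h0] at this

/-- Dividing `f` by `e (m - 1)` leaves a constant, killed by `map_eq_zero`, and a quotient of
smaller degree tested at level `m - 1`. -/
theorem map_mul_eq_zero (h : BiorthogonalData Λ e p) {n m : ℕ} (hm : m ≤ n) {f : K[X]}
    (hf : f.degree < m) : Λ m (f * p n) = 0 := by
  induction m generalizing f with
  | zero =>
    have : f = 0 := by
      by_contra h0
      rw [degree_eq_natDegree h0] at hf
      exact absurd (by exact_mod_cast hf) (Nat.not_lt_zero f.natDegree)
    simp [this]
  | succ m ih =>
    obtain ⟨g, r, hfg, hdeg⟩ := exists_eq_mul_add_C (h.degree_e m) f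
    have hg : g.degree < m := by
      rcases eq_or_ne g 0 with h0 | h0
      · simp [h0]
      · rw [hdeg h0, degree_eq_natDegree h0] at hf
        rw [degree_eq_natDegree h0]
        have : g.natDegree + 1 < m + 1 := by exact_mod_cast hf
        exact_mod_cast Nat.lt_of_succ_lt_succ this
    rw [hfg, add_mul, map_add, map_C_mul, h.map_eq_zero n (m + 1) (by omega) hm,
      mul_right_comm, h.map_mul_e, ih (by omega) hg]
    simp

/-- The same descent now loses exactly one degree per level and ends at a nonzero constant times `Λ
0 (p n)`. -/
theorem map_mul_ne_zero (h : BiorthogonalData Λ e p) {n m : ℕ} (hm : m ≤ n) {f : K[X]}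
    (hf : f.degree = m) : Λ m (f * p n) ≠ 0 := by
  induction m generalizing f with
  | zero =>
    have hf' : f.degree = 0 := by simpa using hf
    obtain ⟨r, rfl⟩ : ∃ r, f = C r := ⟨_, eq_C_of_degree_eq_zero hf'⟩
    rw [map_C_mul]
    refine mul_ne_zero ?_ (h.map_zero_ne n)
    rintro rfl
    simp at hf'
  | succ m ih =>
    obtain ⟨g, r, hfg, hdeg⟩ := exists_eq_mul_add_C (h.degree_e m) f
    have hg : g.degree = m := by
      rcases eq_or_ne g 0 with h0 | h0
      · have := degree_C_le (a := r)
        rw [h0, zero_mul, zero_add] at hfg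
        rw [← hfg, hf] at this
        exact absurd (by exact_mod_cast this) (Nat.not_succ_le_zero m)
      · rw [hdeg h0, degree_eq_natDegree h0] at hf
        rw [degree_eq_natDegree h0]
        have : g.natDegree + 1 = m + 1 := by exact_mod_cast hf
        exact_mod_cast Nat.succ_injective this
    rw [hfg, add_mul, map_add, map_C_mul, h.map_eq_zero n (m + 1) (by omega) hm,
      mul_right_comm, h.map_mul_e]
    simpa using ih (by omega) hg

theorem degree_mul_e_lt (h : BiorthogonalData Λ e p) {m : ℕ} (n : ℕ) {f : K[X]}
    (hf : f.degree < m) : (f * e n).degree < (m + 1 : ℕ) := by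
  rcases eq_or_ne f 0 with rfl | h0
  · simp
  · rw [degree_mul, h.degree_e, degree_eq_natDegree h0] at *
    have : f.natDegree < m := by exact_mod_cast hf
    exact_mod_cast Nat.succ_lt_succ this

/-- Orthogonality of `f` for `Λ n` implies orthogonality for `Λ m`, `m ≤ n`. -/
theorem orthogonal_of_le (h : BiorthogonalData Λ e p) {m n : ℕ} (hmn : m ≤ n) {g : K[X]}
    (hg : ∀ f : K[X], f.degree < n → Λ n (f * g) = 0) :
    ∀ f : K[X], f.degree < m → Λ m (f * g) = 0 := by
  induction n, hmn using Nat.le_induction with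
  | base => exact hg
  | succ n _ ih =>
    refine ih fun f hf => ?_
    rw [← h.map_mul_e, mul_right_comm]
    exact hg _ (h.degree_mul_e_lt n hf)

theorem exists_degree_sub_lt (h : BiorthogonalData Λ e p) {n : ℕ} {g : K[X]} (hg : g.degree ≤ n) :
    ∃ t : K, (g - C t * p n).degree < n := by
  have hl : (p n).coeff n ≠ 0 := by
    have := leadingCoeff_ne_zero.mpr (h.p_ne_zero n)
    rwa [leadingCoeff, natDegree_eq_of_degree_eq_some (h.degree_p n)] at this
  refine ⟨g.coeff n / (p n).coeff n, ?_⟩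
  rw [degree_lt_iff_coeff_zero]
  intro m hm
  rcases hm.eq_or_lt with rfl | hm
  · simp [hl]
  · have h1 : g.coeff m = 0 := coeff_eq_zero_of_degree_lt (hg.trans_lt (by exact_mod_cast hm))
    have h2 : (p n).coeff m = 0 :=
      coeff_eq_zero_of_degree_lt ((h.degree_p n).trans_lt (by exact_mod_cast hm))
    simp [h1, h2]

/-- Suppose `g` has degree `r < n`. Orthogonality descends to level `r`, where induction makes `g` a
multiple of `p r`, and to level `r + 1`, where testing against `1` contradicts `Λ (r + 1) (p r) ≠
0`. -/
theorem eq_zero_of_orthogonal (h : BiorthogonalData Λ e p) (n : ℕ) {g : K[X]}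
    (hdeg : g.degree < n) (hg : ∀ f : K[X], f.degree < n → Λ n (f * g) = 0) : g = 0 := by
  induction n using Nat.strong_induction_on generalizing g with
  | _ n ih =>
    by_contra h0
    have hr : g.natDegree < n := by
      rw [degree_eq_natDegree h0] at hdeg
      exact_mod_cast hdeg
    obtain ⟨t, ht⟩ := h.exists_degree_sub_lt (degree_le_natDegree (p := g))
    have hgt : g - C t * p g.natDegree = 0 := by
      refine ih _ hr ht fun f hf => ?_
      rw [mul_sub, map_sub, h.orthogonal_of_le hr.le hg f hf, mul_left_comm, map_C_mul,
        h.map_mul_eq_zero le_rfl hf]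
      simp
    have hgt' : g = C t * p g.natDegree := sub_eq_zero.mp hgt
    have h1 := h.orthogonal_of_le (Nat.succ_le_of_lt hr) hg 1 (by
      rw [degree_one]
      exact_mod_cast Nat.succ_pos _)
    rw [one_mul] at h1
    have h2 := congrArg (Λ (g.natDegree + 1)) hgt'
    rw [map_C_mul] at h2
    replace h1 := h2.symm.trans h1
    rcases mul_eq_zero.mp h1 with h1 | h1
    · exact h0 (by rw [hgt', h1]; simp)
    · exact h.map_succ_ne _ h1

theorem exists_eq_C_mul_of_orthogonal (h : BiorthogonalData Λ e p) {n : ℕ} {g : K[X]}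
    (hdeg : g.degree ≤ n) (hg : ∀ f : K[X], f.degree < n → Λ n (f * g) = 0) :
    ∃ t : K, g = C t * p n := by
  obtain ⟨t, ht⟩ := h.exists_degree_sub_lt hdeg
  refine ⟨t, sub_eq_zero.mp (h.eq_zero_of_orthogonal n ht fun f hf => ?_)⟩
  rw [mul_sub, map_sub, hg f hf, mul_left_comm, map_C_mul, h.map_mul_eq_zero le_rfl hf]
  simp

/-- It is enough to test orthogonality against powers of `X`. -/
theorem map_mul_eq_zero_of_X_pow (Λ : K[X] →ₗ[K] K) {n : ℕ} {g : K[X]}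
    (hg : ∀ k < n, Λ (X ^ k * g) = 0) {f : K[X]} (hf : f.degree < n) : Λ (f * g) = 0 := by
  rcases eq_or_ne f 0 with rfl | h0
  · simp
  · rw [as_sum_range' f n ((natDegree_lt_iff_degree_lt h0).mpr hf), Finset.sum_mul, map_sum]
    refine Finset.sum_eq_zero fun k hk => ?_
    rw [← C_mul_X_pow_eq_monomial, mul_assoc, map_C_mul, hg k (Finset.mem_range.mp hk), mul_zero]

theorem orthogonal_iff (h : BiorthogonalData Λ e p) {n : ℕ} {g : K[X]} (hdeg : g.degree ≤ n) :
    (∀ k < n, Λ n (X ^ k * g) = 0) ↔ ∃ t : K, g = C t * p n := by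
  constructor
  · intro hg
    exact h.exists_eq_C_mul_of_orthogonal hdeg fun f hf => map_mul_eq_zero_of_X_pow _ hg hf
  · rintro ⟨t, rfl⟩ k hk
    rw [mul_left_comm, map_C_mul, h.map_mul_eq_zero le_rfl, mul_zero]
    rw [degree_X_pow]
    exact_mod_cast hk

/-- The polynomials `p n` rescaled to be monic. -/
theorem monic_normalize (h : BiorthogonalData Λ e p) :
    BiorthogonalData Λ e fun n => C (p n).leadingCoeff⁻¹ * p n := by
  have hl n : (p n).leadingCoeff⁻¹ ≠ 0 := inv_ne_zero (leadingCoeff_ne_zero.mpr (h.p_ne_zero n))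
  refine ⟨h.degree_e, fun n => ?_, h.map_mul_e, fun n m h1 h2 => ?_, fun n => ?_, fun n => ?_⟩
  · rw [degree_C_mul (hl n), h.degree_p]
  · rw [map_C_mul, h.map_eq_zero n m h1 h2, mul_zero]
  · rw [map_C_mul]
    exact mul_ne_zero (hl n) (h.map_zero_ne n)
  · rw [map_C_mul]
    exact mul_ne_zero (hl n) (h.map_succ_ne n)

/-- The three term recurrence of type `R_I`. -/
theorem exists_recurrence (h : BiorthogonalData Λ e p) (hp : ∀ n, (p n).Monic) (n : ℕ) :
    ∃ β l : K, l ≠ 0 ∧ p (n + 2) = (X - C β) * p (n + 1) - C l * e n * p n := by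
  have hX n : Λ n (X ^ n * p n) ≠ 0 := h.map_mul_ne_zero le_rfl (degree_X_pow n)
  -- This ratio is forced by the test against `X ^ n` at level `n + 1`; the tests against lower
  -- powers vanish for any `l`.
  set l := Λ (n + 1) (X ^ (n + 1) * p (n + 1)) / Λ n (X ^ n * p n) with hl
  have hmon : (X * p (n + 1)).Monic := monic_X.mul (hp _)
  have hdeg : (p (n + 2) - X * p (n + 1) + C l * e n * p n).degree ≤ ((n + 1 : ℕ) : WithBot ℕ) := by
    refine (degree_add_le _ _).trans (max_le ?_ ?_)
    · have hlt : (p (n + 2) - X * p (n + 1)).degree < ((n + 2 : ℕ) : WithBot ℕ) := by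
        rw [← h.degree_p (n + 2)]
        refine degree_sub_lt_left ?_ (h.p_ne_zero _) ?_
        · rw [degree_mul, h.degree_p, h.degree_p, degree_X]
          norm_cast
          ring
        · rw [(hp _).leadingCoeff, hmon.leadingCoeff]
      rw [degree_lt_iff_coeff_zero] at hlt
      rw [degree_le_iff_coeff_zero]
      intro m hm
      exact hlt m (by exact_mod_cast hm)
    · rw [degree_mul, degree_mul, h.degree_e, h.degree_p]
      have := degree_C_le (a := l)
      calc (C l).degree + 1 + (n : WithBot ℕ) ≤ 0 + 1 + n := by gcongr
        _ = _ := by push_cast; ring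
  obtain ⟨t, ht⟩ := (h.orthogonal_iff hdeg).mp fun k hk => by
    have h1 : Λ (n + 1) (X ^ k * p (n + 2)) = 0 :=
      h.map_mul_eq_zero (by omega) (by rw [degree_X_pow]; exact_mod_cast hk)
    have h2 : Λ (n + 1) (X ^ k * (X * p (n + 1))) = Λ (n + 1) (X ^ (k + 1) * p (n + 1)) := by
      rw [pow_succ, mul_assoc]
    have h3 : Λ (n + 1) (X ^ k * (C l * e n * p n)) = l * Λ n (X ^ k * p n) := by
      rw [← h.map_mul_e n, ← map_C_mul]
      congr 1
      ring
    rw [mul_add, mul_sub, map_add, map_sub, h1, h2, h3]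
    rcases (Nat.lt_succ_iff.mp hk).eq_or_lt with rfl | hk'
    · rw [hl, div_mul_cancel₀ _ (hX k)]
      ring
    · rw [h.map_mul_eq_zero le_rfl (by rw [degree_X_pow]; exact_mod_cast Nat.succ_lt_succ hk'),
        h.map_mul_eq_zero le_rfl (by rw [degree_X_pow]; exact_mod_cast hk')]
      ring
  refine ⟨-t, l, div_ne_zero (hX _) (hX _), ?_⟩
  rw [map_neg]
  linear_combination ht

/-- Otherwise `p (n + 1) = g * e n`, and `g` is orthogonal at level `n` to all powers up to `X ^ n`,
one more than allowed: the first `n` make `g` a multiple of `p n`, the last contradicts the nonzero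
norm. -/
theorem eval_ne_zero (h : BiorthogonalData Λ e p) (n : ℕ) {x : K} (hx : (e n).eval x = 0) :
    (p (n + 1)).eval x ≠ 0 := by
  intro hp
  obtain ⟨g, r, hg, hdeg⟩ := exists_eq_mul_add_C (h.degree_e n) (p (n + 1))
  have hr : r = 0 := by
    rw [hg] at hp
    simpa [hx] using hp
  rw [hr, map_zero, add_zero] at hg
  have hg0 : g ≠ 0 := by
    rintro rfl
    exact h.p_ne_zero (n + 1) (by simpa using hg)
  have hgd : g.degree = n := by
    have h1 := hdeg hg0
    rw [h.degree_p, degree_eq_natDegree hg0] at h1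
    rw [degree_eq_natDegree hg0]
    have : n + 1 = g.natDegree + 1 := by exact_mod_cast h1
    exact_mod_cast (Nat.succ_injective this).symm
  have horth k (hk : k < n + 1) : Λ n (X ^ k * g) = 0 := by
    rw [← h.map_mul_e, mul_assoc, ← hg]
    exact h.map_mul_eq_zero le_rfl (by rw [degree_X_pow]; exact_mod_cast hk)
  obtain ⟨t, ht⟩ := (h.orthogonal_iff hgd.le).mp fun k hk => horth k (by omega)
  have h1 := horth n (by omega)
  rw [ht, mul_left_comm, map_C_mul] at h1
  rcases mul_eq_zero.mp h1 with h1 | h1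
  · exact hg0 (by rw [ht, h1]; simp)
  · exact h.map_mul_ne_zero le_rfl (degree_X_pow n) h1

end BiorthogonalData

/-! ### q-shifted factorials with integer index -/

theorem qPoch_succ (q A : K) (n : ℕ) : qPoch q A (n + 1) = qPoch q A n * (1 - A * q ^ n) :=
  Finset.prod_range_succ _ _

theorem qPoch_succ_left (q A : K) (n : ℕ) :
    qPoch q A (n + 1) = (1 - A) * qPoch q (A * q) n := by
  rw [qPoch, Finset.prod_range_succ', mul_comm]
  simp [qPoch, pow_succ', mul_assoc]

theorem qPoch_ne_zero {q A : K} {n : ℕ} (h : ∀ i < n, A * q ^ i ≠ 1) : qPoch q A n ≠ 0 :=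
  Finset.prod_ne_zero_iff.mpr fun i hi => sub_ne_zero.mpr (h i (Finset.mem_range.mp hi)).symm

theorem qPochInt_neg (q A : K) (n : ℕ) :
    qPochInt q A (-(n : ℤ)) = (qPoch q (A * q ^ (-(n : ℤ))) n)⁻¹ := by
  cases n with
  | zero =>
    rw [show -((0 : ℕ) : ℤ) = Int.ofNat 0 from rfl]
    simp [qPochInt, qPoch]
  | succ m =>
    rw [show -((m + 1 : ℕ) : ℤ) = Int.negSucc m from rfl]
    simp [qPochInt, Int.negSucc_eq]

theorem qPochInt_natCast (q A : K) (n : ℕ) : qPochInt q A n = qPoch q A n := rfl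

/-- `(A q^{-N}; q)_N` and `(A; q)_{-N}` are inverse to each other. -/
theorem inv_qPochInt_shift {q : K} (hq : q ≠ 0) (A : K) (N : ℤ) :
    (qPochInt q (A * q ^ (-N)) N)⁻¹ = qPochInt q A (-N) := by
  obtain ⟨n, rfl | rfl⟩ := N.eq_nat_or_neg
  · rw [qPochInt_neg, qPochInt_natCast]
  · rw [neg_neg, qPochInt_neg, qPochInt_natCast, inv_inv, mul_assoc, ← zpow_add₀ hq]
    simp

theorem qPochInt_negSucc_mul {q A : K} (hq : q ≠ 0) (n : ℕ) :
    (qPochInt q A (-((n + 1 : ℕ) : ℤ)))⁻¹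
      = (1 - A * q ^ (-((n + 1 : ℕ) : ℤ))) * (qPochInt q A (-(n : ℤ)))⁻¹ := by
  rw [qPochInt_neg, qPochInt_neg, inv_inv, inv_inv, qPoch_succ_left, mul_assoc A, ← zpow_add_one₀ hq]
  congr 4
  push_cast
  ring

/-- The reciprocal of `(A; q)_N` is stepped down without any condition at negative indices. -/
theorem inv_qPochInt_eq {q A : K} (hq : q ≠ 0) {N : ℤ} (hA : ∀ i : ℕ, (i : ℤ) = N → A * q ^ i ≠ 1) :
    (qPochInt q A N)⁻¹ = (1 - A * q ^ N) * (qPochInt q A (N + 1))⁻¹ := by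
  obtain ⟨n, rfl | rfl⟩ := N.eq_nat_or_neg
  · have h : (1 - A * q ^ n) ≠ 0 := sub_ne_zero.mpr (hA n rfl).symm
    rw [show (n : ℤ) + 1 = (n + 1 : ℕ) by simp, qPochInt_natCast, qPochInt_natCast, qPoch_succ,
      zpow_natCast, mul_inv, mul_left_comm, mul_inv_cancel₀ h, mul_one]
  · cases n with
    | zero =>
      have h : (1 - A) ≠ 0 := by simpa using sub_ne_zero.mpr (hA 0 (by simp)).symm
      rw [show -((0 : ℕ) : ℤ) + 1 = (1 : ℕ) by simp, show -((0 : ℕ) : ℤ) = (0 : ℕ) by simp,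
        qPochInt_natCast, qPochInt_natCast]
      simp [qPoch, h]
    | succ n =>
      rw [qPochInt_negSucc_mul hq, show -((n + 1 : ℕ) : ℤ) + 1 = -(n : ℤ) by push_cast; ring]

/-- At a negative index the symbol is an inverse, so the factor to be cancelled must be nonzero; at
other indices a factor is merely appended to a product. -/
theorem qPochInt_add_one {q A : K} (hq : q ≠ 0) {N : ℤ} (hA : N < 0 → A * q ^ N ≠ 1) :
    qPochInt q A (N + 1) = (1 - A * q ^ N) * qPochInt q A N := by
  rcases lt_or_ge N 0 with h | h
  · have h0 : (1 - A * q ^ N) ≠ 0 := sub_ne_zero.mpr (hA h).symm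
    have := inv_qPochInt_eq (A := A) hq (N := N) (fun i hi => by omega)
    rw [← inv_inv (qPochInt q A N), this, mul_inv, inv_inv, mul_inv_cancel_left₀ h0]
  · lift N to ℕ using h
    rw [show (N : ℤ) + 1 = (N + 1 : ℕ) by simp, qPochInt_natCast, qPochInt_natCast, qPoch_succ,
      zpow_natCast, mul_comm]

theorem qPochInt_add_natCast {q A : K} (hq : q ≠ 0) {N : ℤ} (s : ℕ)
    (hA : ∀ M : ℤ, M < 0 → A * q ^ M ≠ 1) :
    qPochInt q A (N + s) = qPoch q (A * q ^ N) s * qPochInt q A N := by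
  induction s with
  | zero => simp [qPoch]
  | succ s ih =>
    rw [Nat.cast_succ, ← add_assoc, qPochInt_add_one hq (hA (N + s)), ih, qPoch_succ, zpow_add₀ hq,
      zpow_natCast]
    ring

theorem inv_qPochInt_eq_natCast {q A : K} (hq : q ≠ 0) {N : ℤ} (s : ℕ)
    (hA : ∀ i : ℕ, A * q ^ i ≠ 1) :
    (qPochInt q A N)⁻¹ = qPoch q (A * q ^ N) s * (qPochInt q A (N + s))⁻¹ := by
  induction s with
  | zero => simp [qPoch]
  | succ s ih =>
    rw [Nat.cast_succ, ← add_assoc, ih, inv_qPochInt_eq hq fun i _ => hA i, qPoch_succ,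
      zpow_add₀ hq, zpow_natCast]
    ring

theorem qPochInt_ne_zero {q A : K} {N : ℤ} (h : ∀ i : ℤ, 0 ≤ i → i < N → A * q ^ i ≠ 1)
    (h' : ∀ i : ℤ, i < 0 → N ≤ i → A * q ^ i ≠ 1) (hq : q ≠ 0) : qPochInt q A N ≠ 0 := by
  obtain ⟨n, rfl | rfl⟩ := N.eq_nat_or_neg
  · refine qPoch_ne_zero fun i hi => ?_
    have := h i (by omega) (by omega)
    rwa [zpow_natCast] at this
  · rw [qPochInt_neg]
    refine inv_ne_zero (qPoch_ne_zero fun i hi => ?_)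
    have := h' (-n + i) (by omega) (by omega)
    rwa [zpow_add₀ hq, zpow_natCast, ← mul_assoc] at this

/-! ### Terminating sums as divided differences at powers of q -/

/-- The weights `(q^{-n}; q)_k q^k / (q; q)_k` are, up to the factor `(q; q)_n`, the weights of
Lagrange interpolation at the nodes `1, q, …, q^n`. -/
theorem weight_mul_prod_sub {q : K} (hq : q ≠ 0) (m k : ℕ) :
    qPoch q (q ^ (-((m + k : ℕ) : ℤ))) k * q ^ k *
      ((∏ l ∈ Finset.range k, (q ^ k - q ^ l)) * ∏ s ∈ Finset.range m, (q ^ k - q ^ (k + 1 + s)))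
      = qPoch q q (m + k) * qPoch q q k := by
  have hB (k : ℕ) :
      ∏ s ∈ Finset.range m, (q ^ k - q ^ (k + 1 + s)) = (q ^ k) ^ m * qPoch q q m := by
    have h (s : ℕ) : q ^ k - q ^ (k + 1 + s) = q ^ k * (1 - q * q ^ s) := by ring
    simp [h, Finset.prod_mul_distrib, qPoch]
  have hA (k : ℕ) : ∏ l ∈ Finset.range (k + 1), (q ^ (k + 1) - q ^ l)
      = (q ^ (k + 1) - 1) * (q ^ k * ∏ l ∈ Finset.range k, (q ^ k - q ^ l)) := by
    have h (l : ℕ) : q ^ (k + 1) - q ^ (l + 1) = q * (q ^ k - q ^ l) := by ring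
    rw [Finset.prod_range_succ']
    simp [h, Finset.prod_mul_distrib, mul_comm]
  -- With `n = m + k` and `m` fixed, a step in `k` only rescales the product over later nodes by a
  -- power of `q`, and `hA` handles the earlier nodes.
  induction k with
  | zero =>
    rw [hB]
    simp [qPoch]
  | succ k ih =>
    rw [hB] at ih ⊢
    have hz : q ^ (-((m + (k + 1) : ℕ) : ℤ)) * q = q ^ (-((m + k : ℕ) : ℤ)) := by
      rw [← zpow_add_one₀ hq]
      congr 1
      push_cast
      ring
    have hc : q ^ (-((m + (k + 1) : ℕ) : ℤ)) * (q ^ m * q ^ k * q) = 1 := by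
      rw [← pow_add, ← pow_succ, zpow_neg, zpow_natCast]
      exact inv_mul_cancel₀ (pow_ne_zero _ hq)
    rw [hA, qPoch_succ_left, hz, ← add_assoc, qPoch_succ q q (m + k), qPoch_succ q q k]
    rw [← add_assoc] at hc
    linear_combination ((1 - q ^ (-((m + k + 1 : ℕ) : ℤ))) * q * (q ^ (k + 1) - 1) * q ^ k * q ^ m)
      * ih + (1 - q * q ^ k) * qPoch q q (m + k) * qPoch q q k * hc

theorem pow_injective_of_ne_one {q : K} (hq0 : q ≠ 0) (hq : ∀ m : ℕ, 1 ≤ m → q ^ m ≠ 1) :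
    Function.Injective (fun k : ℕ => q ^ k) := by
  intro i j hij
  by_contra hne
  wlog h : i < j generalizing i j
  · exact this hij.symm (Ne.symm hne) (by omega)
  refine hq (j - i) (by omega) ?_
  have h1 : q ^ i * q ^ (j - i) = q ^ i * 1 := by
    rw [← pow_add, Nat.add_sub_cancel' h.le, mul_one]
    exact hij.symm
  exact mul_left_cancel₀ (pow_ne_zero _ hq0) h1

theorem prod_erase_pow_sub (q : K) (m k : ℕ) :
    ∏ j ∈ (Finset.range (m + k + 1)).erase k, (q ^ k - q ^ j)
      = (∏ l ∈ Finset.range k, (q ^ k - q ^ l)) *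
        ∏ s ∈ Finset.range m, (q ^ k - q ^ (k + 1 + s)) := by
  -- Replacing the zero factor at `j = k` by `1` turns the punctured product into one over a full
  -- range, which can be split at `k`.
  let g : ℕ → K := fun j => if j = k then 1 else q ^ k - q ^ j
  have h1 : ∏ j ∈ (Finset.range (m + k + 1)).erase k, (q ^ k - q ^ j)
      = ∏ j ∈ (Finset.range (m + k + 1)).erase k, g j :=
    Finset.prod_congr rfl fun j hj => by simp [g, (Finset.mem_erase.mp hj).1]
  rw [h1, Finset.prod_erase _ (by simp [g]), show m + k + 1 = k + 1 + m by ring,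
    Finset.prod_range_add, Finset.prod_range_succ]
  simp only [g, if_true, mul_one]
  congr 1
  · exact Finset.prod_congr rfl fun j hj => by rw [if_neg (Finset.mem_range.mp hj).ne]
  · exact Finset.prod_congr rfl fun j _ => by rw [if_neg (by omega)]

/-- The weight `(q^{-n}; q)_k q^k / (q; q)_k` of a terminating basic hypergeometric series. -/
def hypWeight (q : K) (n k : ℕ) : K := qPoch q (q ^ (-(n : ℤ))) k * q ^ k / qPoch q q k

section sums

variable {q : K}

theorem qPoch_self_ne_zero (hq : ∀ m : ℕ, 1 ≤ m → q ^ m ≠ 1) (n : ℕ) : qPoch q q n ≠ 0 :=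
  qPoch_ne_zero fun i _ => by
    rw [← pow_succ']
    exact hq _ (by omega)

theorem hypWeight_eq (hq0 : q ≠ 0) (hq : ∀ m : ℕ, 1 ≤ m → q ^ m ≠ 1)
    {n k : ℕ} (hk : k ∈ Finset.range (n + 1)) :
    hypWeight q n k
      = qPoch q q n * Lagrange.nodalWeight (Finset.range (n + 1)) (fun k => q ^ k) k := by
  obtain ⟨m, rfl⟩ : ∃ m, n = m + k :=
    ⟨n - k, by have := Finset.mem_range.mp hk; omega⟩
  have hne : ∏ j ∈ (Finset.range (m + k + 1)).erase k, (q ^ k - q ^ j) ≠ 0 := by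
    refine Finset.prod_ne_zero_iff.mpr fun j hj => sub_ne_zero.mpr fun h => ?_
    exact (Finset.mem_erase.mp hj).1 (pow_injective_of_ne_one hq0 hq h).symm
  rw [Lagrange.nodalWeight, Finset.prod_inv_distrib, hypWeight, ← div_eq_mul_inv,
    div_eq_div_iff (qPoch_self_ne_zero hq k) hne, prod_erase_pow_sub, weight_mul_prod_sub hq0]

/-- Lagrange interpolation at `n + 1` nodes: the divided difference of order `n` reads off the
coefficient of degree `n`. -/
theorem sum_hypWeight_mul_eval (hq0 : q ≠ 0) (hq : ∀ m : ℕ, 1 ≤ m → q ^ m ≠ 1)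
    {n : ℕ} {f : K[X]} (hf : f.degree < (n + 1 : ℕ)) :
    ∑ k ∈ Finset.range (n + 1), hypWeight q n k * f.eval (q ^ k) = qPoch q q n * f.coeff n := by
  have h := Lagrange.coeff_eq_sum (s := Finset.range (n + 1)) (v := fun k => q ^ k)
    ((pow_injective_of_ne_one hq0 hq).injOn) (P := f) (by simpa using hf)
  rw [Finset.card_range, Nat.add_sub_cancel] at h
  rw [h, Finset.mul_sum]
  refine Finset.sum_congr rfl fun k hk => ?_
  rw [hypWeight_eq hq0 hq hk, Lagrange.nodalWeight, Finset.prod_inv_distrib]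
  ring

/-- The polynomial `(u y; q)_s` in `y`. -/
theorem exists_eval_eq_qPoch (q u : K) (s : ℕ) :
    ∃ f : K[X], f.natDegree ≤ s ∧ f.coeff s = ∏ i ∈ Finset.range s, -(u * q ^ i) ∧
      ∀ y, f.eval y = qPoch q (u * y) s := by
  induction s with
  | zero => exact ⟨1, by simp, by simp, by simp [qPoch]⟩
  | succ s ih =>
    obtain ⟨f, h1, h2, h3⟩ := ih
    have h4 : (1 - C (u * q ^ s) * X).natDegree ≤ 1 := by compute_degree
    refine ⟨f * (1 - C (u * q ^ s) * X), natDegree_mul_le.trans (by omega), ?_, fun y => ?_⟩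
    · rw [coeff_mul_add_eq_of_natDegree_le h1 h4, h2, Finset.prod_range_succ]
      rw [coeff_sub, coeff_C_mul_X]
      simp [coeff_one]
    · rw [eval_mul, h3, qPoch_succ]
      simp only [eval_sub, eval_one, eval_mul, eval_C, eval_X]
      ring

theorem sum_hypWeight_mul_qPoch_eq_zero (hq0 : q ≠ 0) (hq : ∀ m : ℕ, 1 ≤ m → q ^ m ≠ 1)
    {n s t : ℕ} (hst : s + t < n) (u v : K) :
    ∑ k ∈ Finset.range (n + 1),
      hypWeight q n k * (qPoch q (u * q ^ k) s * qPoch q (v * q ^ k) t) = 0 := by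
  obtain ⟨f, hf, -, hf'⟩ := exists_eval_eq_qPoch q u s
  obtain ⟨g, hg, -, hg'⟩ := exists_eval_eq_qPoch q v t
  have hn : (f * g).natDegree < n := by
    have := natDegree_mul_le (p := f) (q := g)
    omega
  have h := sum_hypWeight_mul_eval hq0 hq (n := n) (f := f * g)
    (degree_le_natDegree.trans_lt (by exact_mod_cast Nat.lt_succ_of_lt hn))
  rw [coeff_eq_zero_of_natDegree_lt hn, mul_zero] at h
  simpa [hf', hg'] using h

/-- For `α ≠ 0`, Lagrange's formula at the point `α⁻¹`, off the nodes, expresses `(u / α; q)_n` as a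
multiple of this sum, and `hu` makes that value nonzero. For `α = 0` the pole is at infinity and the
leading coefficient takes its place. -/
theorem sum_hypWeight_mul_qPoch_div_ne_zero (hq0 : q ≠ 0) (hq : ∀ m : ℕ, 1 ≤ m → q ^ m ≠ 1)
    {n : ℕ} {u α : K} (hα : ∀ k ≤ n, α * q ^ k ≠ 1)
    (hu : ∀ i < n, u * q ^ i ≠ α) :
    ∑ k ∈ Finset.range (n + 1),
      hypWeight q n k * (qPoch q (u * q ^ k) n / (1 - α * q ^ k)) ≠ 0 := by
  obtain ⟨f, hf, hfn, hf'⟩ := exists_eval_eq_qPoch q u n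
  have hdeg : f.degree < (n + 1 : ℕ) :=
    degree_le_natDegree.trans_lt (by exact_mod_cast Nat.lt_succ_of_le hf)
  have hqn := qPoch_self_ne_zero hq n
  rcases eq_or_ne α 0 with rfl | hα0
  · have h := sum_hypWeight_mul_eval hq0 hq hdeg
    simp only [zero_mul, sub_zero, div_one]
    simp only [hf'] at h
    rw [h, hfn]
    exact mul_ne_zero hqn (Finset.prod_ne_zero_iff.mpr fun i hi =>
      neg_ne_zero.mpr (hu i (Finset.mem_range.mp hi)))
  · have hinj : Set.InjOn (fun k : ℕ => q ^ k) (Finset.range (n + 1)) :=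
      (pow_injective_of_ne_one hq0 hq).injOn
    have hnode : ∀ k ∈ Finset.range (n + 1), α⁻¹ ≠ q ^ k := by
      intro k hk h
      refine hα k (Nat.lt_succ_iff.mp (Finset.mem_range.mp hk)) ?_
      rw [← h, mul_inv_cancel₀ hα0]
    have h := Lagrange.eval_interpolate_not_at_node (fun k => f.eval (q ^ k)) hnode
    rw [← Lagrange.eq_interpolate hinj (by simpa using hdeg), hf'] at h
    have hne : qPoch q (u * α⁻¹) n ≠ 0 := qPoch_ne_zero fun i hi h1 => hu i hi (by
      field_simp at h1
      exact h1)
    rw [h] at hne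
    have hsum := right_ne_zero_of_mul hne
    convert mul_ne_zero (mul_ne_zero hqn (inv_ne_zero hα0)) hsum using 1
    rw [Finset.mul_sum]
    refine Finset.sum_congr rfl fun k hk => ?_
    have h1 : (1 - α * q ^ k) = α * (α⁻¹ - q ^ k) := by
      rw [mul_sub, mul_inv_cancel₀ hα0]
    rw [hypWeight_eq hq0 hq hk, hf', h1, div_eq_mul_inv, mul_inv]
    ring

end sums

/-! ### Linear factors and the basis `(az, a/z; q)_k` -/

/-- The linear polynomial `(1 - A z)(1 - A / z)` in `x = (z + 1/z)/2`. -/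
def pairFactor (A : K) : K[X] := 1 - C (2 * A) * X + C (A ^ 2)

theorem pairPoch_succ (q A : K) (n : ℕ) :
    pairPoch q A (n + 1) = pairPoch q A n * pairFactor (A * q ^ n) := by
  rw [pairPoch, Finset.prod_range_succ, ← pairPoch, pairFactor]
  congr 5 <;> ring

theorem den_eq_prod (q b : K) (n : ℕ) :
    den q b n = ∏ j ∈ Finset.range n, pairFactor (b * q ^ (-1 - (j : ℤ))) := by
  refine Finset.prod_congr rfl fun j _ => ?_
  rw [pairFactor, mul_pow, ← mul_assoc, ← zpow_natCast (q ^ (-1 - (j : ℤ))), ← zpow_mul]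
  congr 5
  push_cast
  ring

theorem den_succ (q b : K) (n : ℕ) :
    den q b (n + 1) = den q b n * pairFactor (b * q ^ (-1 - (n : ℤ))) := by
  rw [den_eq_prod, den_eq_prod, Finset.prod_range_succ]

theorem degree_pairFactor (h2 : (2 : K) ≠ 0) {A : K} (hA : A ≠ 0) :
    (pairFactor A).degree = 1 := by
  have h : pairFactor A = C (-(2 * A)) * X + C (1 + A ^ 2) := by
    simp only [pairFactor, map_neg, map_add, map_one]
    ring
  rw [h, degree_linear (neg_ne_zero.mpr (mul_ne_zero h2 hA))]

theorem degree_pairPoch (h2 : (2 : K) ≠ 0) {q A : K} (hq : q ≠ 0) (hA : A ≠ 0) (n : ℕ) :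
    (pairPoch q A n).degree = n := by
  induction n with
  | zero => simp [pairPoch]
  | succ n ih =>
    rw [pairPoch_succ, degree_mul, ih, degree_pairFactor h2 (mul_ne_zero hA (pow_ne_zero _ hq))]
    rfl

/-- `B / A` is the ratio of the coefficients of `x`, and the constant is the value of `pairFactor B`
at `z = A`, a zero of `pairFactor A`. -/
theorem pairFactor_eq {A : K} (hA : A ≠ 0) (B : K) :
    pairFactor B = C (B / A) * pairFactor A + C ((1 - B / A) * (1 - A * B)) := by
  have h1 : C (B / A) * C A = C B := by rw [← C_mul, div_mul_cancel₀ _ hA]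
  have h2 : (1 - B / A) * (1 - A * B) = 1 - B / A - A * B + B ^ 2 := by
    field_simp
    ring
  rw [h2]
  simp only [pairFactor, map_add, map_sub, map_one, map_mul, map_pow]
  linear_combination (C 2 * X - C A) * h1

/-- The polynomials `(a z, a / z; q)_k` as a basis of `K[X]`. -/
def pairBasis (h2 : (2 : K) ≠ 0) {q a : K} (hq : q ≠ 0) (ha : a ≠ 0) : Module.Basis ℕ K K[X] :=
  Polynomial.Sequence.basis ⟨pairPoch q a, degree_pairPoch h2 hq ha⟩ fun i =>
    IsUnit.mk0 _ (leadingCoeff_ne_zero.mpr (Polynomial.Sequence.ne_zero _ i))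

theorem pairBasis_apply (h2 : (2 : K) ≠ 0) {q a : K} (hq : q ≠ 0) (ha : a ≠ 0) (k : ℕ) :
    pairBasis h2 hq ha k = pairPoch q a k :=
  Polynomial.Sequence.basis_eq_self _ _ k

/-! ### Gluing functionals on the space of fractions -/

/-- `p ↦ p / d_m` as a linear map. -/
def fracMap (d : ℕ → K[X]) (m : ℕ) : K[X] →ₗ[K] ratSpace d where
  toFun p := frac d p m
  map_add' p r := Subtype.ext (by simp [frac, add_div])
  map_smul' t p := Subtype.ext (by simp [frac, Algebra.smul_def, mul_div_assoc])

theorem fracMap_apply (d : ℕ → K[X]) (m : ℕ) (p : K[X]) : fracMap d m p = frac d p m := rfl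

theorem frac_mul_mul {d : ℕ → K[X]} {m n : ℕ} {g : K[X]} (hg : g ≠ 0) (h : d n = d m * g)
    (p : K[X]) : frac d (p * g) n = frac d p m := by
  refine Subtype.ext ?_
  simp only [frac, h, map_mul]
  exact mul_div_mul_right _ _ (by simpa using hg)

theorem exists_eq_frac {d : ℕ → K[X]} {e : ℕ → K[X]} (he : ∀ n, e n ≠ 0)
    (hd : ∀ n, d (n + 1) = d n * e n) (v : ratSpace d) : ∃ (p : K[X]) (m : ℕ), v = frac d p m := by
  have lift (m n : ℕ) (hmn : m ≤ n) (p : K[X]) : ∃ p' : K[X], frac d p m = frac d p' n := by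
    induction n, hmn using Nat.le_induction with
    | base => exact ⟨p, rfl⟩
    | succ n _ ih =>
      obtain ⟨p', hp'⟩ := ih
      exact ⟨p' * e n, hp'.trans (frac_mul_mul (he n) (hd n) p').symm⟩
  obtain ⟨v, hv⟩ := v
  suffices ∃ (p : K[X]) (m : ℕ), v = (frac d p m : RatFunc K) by
    obtain ⟨p, m, h⟩ := this
    exact ⟨p, m, Subtype.ext h⟩
  induction hv using Submodule.span_induction with
  | mem v hv =>
    obtain ⟨n, m, rfl⟩ := hv
    exact ⟨X ^ n, m, rfl⟩
  | zero => exact ⟨0, 0, by simp [frac]⟩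
  | add v w _ _ ihv ihw =>
    obtain ⟨p, m, rfl⟩ := ihv
    obtain ⟨r, n, rfl⟩ := ihw
    obtain ⟨p', hp⟩ := lift m (max m n) (le_max_left _ _) p
    obtain ⟨r', hr⟩ := lift n (max m n) (le_max_right _ _) r
    exact ⟨p' + r', max m n, by
      rw [hp, hr, ← fracMap_apply, ← fracMap_apply, ← fracMap_apply, map_add]
      rfl⟩
  | smul t v _ ih =>
    obtain ⟨p, m, rfl⟩ := ih
    exact ⟨t • p, m, by
      rw [← fracMap_apply, ← fracMap_apply, map_smul]
      rfl⟩

/-- A compatible family of functionals on the polynomials, thought of as numerators over `d_m`,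
glues to a functional on `ratSpace d`. -/
theorem exists_functional {d : ℕ → K[X]} {e : ℕ → K[X]} (he : ∀ n, e n ≠ 0) (hd0 : ∀ n, d n ≠ 0)
    (hd : ∀ n, d (n + 1) = d n * e n) (Λ : ℕ → K[X] →ₗ[K] K)
    (hΛ : ∀ n p, Λ (n + 1) (p * e n) = Λ n p) :
    ∃ L : ratSpace d →ₗ[K] K, ∀ p m, L (frac d p m) = Λ m p := by
  have lift (m n : ℕ) (hmn : m ≤ n) : ∃ g : K[X], d n = d m * g ∧ ∀ p, Λ n (p * g) = Λ m p := by
    induction n, hmn using Nat.le_induction with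
    | base => exact ⟨1, by simp, by simp⟩
    | succ n _ ih =>
      obtain ⟨g, hg, hg'⟩ := ih
      refine ⟨g * e n, by rw [hd, hg, mul_assoc], fun p => ?_⟩
      rw [← mul_assoc, hΛ, hg']
  have inj (m : ℕ) (p r : K[X]) (h : frac d p m = frac d r m) : p = r := by
    have h1 := congrArg Subtype.val h
    have h2 : algebraMap K[X] (RatFunc K) (d m) ≠ 0 := by simpa using hd0 m
    simp only [frac] at h1
    rw [div_left_inj' h2] at h1
    exact RatFunc.algebraMap_injective K h1
  have g_ne (m n : ℕ) (g : K[X]) (h : d n = d m * g) : g ≠ 0 := by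
    rintro rfl
    exact hd0 n (by rw [h, mul_zero])
  have wd (p r : K[X]) (m n : ℕ) (h : frac d p m = frac d r n) : Λ m p = Λ n r := by
    obtain ⟨g, hg, hg'⟩ := lift m (max m n) (le_max_left _ _)
    obtain ⟨f, hf, hf'⟩ := lift n (max m n) (le_max_right _ _)
    rw [← frac_mul_mul (g_ne _ _ _ hg) hg, ← frac_mul_mul (g_ne _ _ _ hf) hf] at h
    rw [← hg', ← hf', inj _ _ _ h]
  -- An arbitrary representative is fixed for each fraction; `wd` makes the value independent of it,
  -- which yields linearity over a common denominator.
  choose num idx hv using exists_eq_frac he hd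
  refine ⟨⟨⟨fun v => Λ (idx v) (num v), fun v w => ?_⟩, fun t v => ?_⟩, fun p m => ?_⟩
  · obtain ⟨g, hg, hg'⟩ := lift (idx v) (max (idx v) (idx w)) (le_max_left _ _)
    obtain ⟨f, hf, hf'⟩ := lift (idx w) (max (idx v) (idx w)) (le_max_right _ _)
    rw [← hg', ← hf', ← map_add]
    refine wd _ _ _ _ ?_
    rw [← hv, ← fracMap_apply, map_add, fracMap_apply, fracMap_apply,
      frac_mul_mul (g_ne _ _ _ hg) hg, frac_mul_mul (g_ne _ _ _ hf) hf, ← hv, ← hv]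
  · simp only [RingHom.id_apply]
    rw [← map_smul]
    refine wd _ _ _ _ ?_
    rw [← hv, ← fracMap_apply, map_smul, fracMap_apply, ← hv]
  · exact wd _ _ _ _ (hv _).symm

/-! ### Moments; existence and uniqueness of the functional -/

/-- The nondegeneracy conditions on the parameters, in terms of integer powers of `q`. -/
structure Admissible (q a b c d : K) : Prop where
  two_ne : (2 : K) ≠ 0
  q_ne : q ≠ 0
  q_pow_ne : ∀ m : ℕ, 1 ≤ m → q ^ m ≠ 1
  a_ne : a ≠ 0
  b_ne : b ≠ 0
  ac_ne : ∀ i : ℕ, a * c * q ^ i ≠ 1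
  ad_ne : ∀ i : ℕ, a * d * q ^ i ≠ 1
  cd_ne : ∀ i : ℕ, c * d * q ^ i ≠ 1
  ab_ne : ∀ M : ℤ, M < 0 → a * b * q ^ M ≠ 1
  bc_ne : ∀ M : ℤ, M < 0 → b * c * q ^ M ≠ 1
  bd_ne : ∀ M : ℤ, M < 0 → b * d * q ^ M ≠ 1
  abcd_ne : ∀ M : ℤ, -1 ≤ M → a * b * c * d * q ^ M ≠ 1

/-- The value of the functional on `(c z, c/z; q)_j (a z, a/z; q)_k / d_n`. -/
def moment (q a b c d : K) (j k n : ℕ) : K :=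
  qPoch q (c * d) j * qPoch q (a * c) (k + j) * qPoch q (a * d) k *
    qPochInt q (a * b) ((k : ℤ) - n) * qPochInt q (b * c) ((j : ℤ) - n) *
    qPochInt q (b * d) (-(n : ℤ)) * (qPochInt q (a * b * c * d) ((k : ℤ) + j - n))⁻¹

theorem isAskeyWilsonFunctional_iff {q : K} (hq : q ≠ 0) (a b c d : K)
    (L : ratSpace (den q b) →ₗ[K] K) :
    IsAskeyWilsonFunctional q a b c d L ↔
      ∀ j k n, L (frac (den q b) (pairPoch q c j * pairPoch q a k) n) = moment q a b c d j k n := by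
  refine forall_congr' fun j => forall_congr' fun k => forall_congr' fun n => ?_
  have h1 (A : K) (i : ℕ) : (qPochInt q (A * q ^ ((i : ℤ) - n)) ((n : ℤ) - i))⁻¹
      = qPochInt q A ((i : ℤ) - n) := by
    have := inv_qPochInt_shift hq A ((n : ℤ) - i)
    rwa [neg_sub] at this
  have h2 : (qPoch q (b * d * q ^ (-(n : ℤ))) n)⁻¹ = qPochInt q (b * d) (-(n : ℤ)) :=
    (qPochInt_neg _ _ _).symm
  rw [div_eq_mul_inv, mul_inv, mul_inv, mul_inv, h1, h1, h2, moment]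
  simp only [mul_assoc]

namespace Admissible

variable {q a b c d : K}

theorem inv_abcd_eq (h : Admissible q a b c d) (N : ℤ) : (qPochInt q (a * b * c * d) N)⁻¹
    = (1 - a * b * c * d * q ^ N) * (qPochInt q (a * b * c * d) (N + 1))⁻¹ := by
  refine inv_qPochInt_eq h.q_ne fun i _ => ?_
  have := h.abcd_ne i (by omega)
  rwa [zpow_natCast] at this

/-- This is what `L` must do to `pairFactor_eq` with `A = a q^k`, `B = c q^j`. Once all shifted
factorials are brought to common indices, an identity of rational functions remains. -/
theorem moment_succ_left (h : Admissible q a b c d) (j k n : ℕ) :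
    moment q a b c d (j + 1) k n = c * q ^ j / (a * q ^ k) * moment q a b c d j (k + 1) n +
      (1 - c * q ^ j / (a * q ^ k)) * (1 - a * q ^ k * (c * q ^ j)) * moment q a b c d j k n := by
  have hq := h.q_ne
  have ha := h.a_ne
  have hab : qPochInt q (a * b) (((k + 1 : ℕ) : ℤ) - n)
      = (1 - a * b * q ^ ((k : ℤ) - n)) * qPochInt q (a * b) ((k : ℤ) - n) := by
    rw [← qPochInt_add_one hq (h.ab_ne _)]
    congr 1
    push_cast
    ring
  have hbc : qPochInt q (b * c) (((j + 1 : ℕ) : ℤ) - n)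
      = (1 - b * c * q ^ ((j : ℤ) - n)) * qPochInt q (b * c) ((j : ℤ) - n) := by
    rw [← qPochInt_add_one hq (h.bc_ne _)]
    congr 1
    push_cast
    ring
  have h1 : ((k : ℤ) + (j + 1 : ℕ) - n) = (k : ℤ) + j - n + 1 := by push_cast; ring
  have h2 : (((k + 1 : ℕ) : ℤ) + j - n) = (k : ℤ) + j - n + 1 := by push_cast; ring
  have hk : q ^ ((k : ℤ) - n) = q ^ k * q ^ (-(n : ℤ)) := by
    rw [sub_eq_add_neg, zpow_add₀ hq, zpow_natCast]
  have hj : q ^ ((j : ℤ) - n) = q ^ j * q ^ (-(n : ℤ)) := by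
    rw [sub_eq_add_neg, zpow_add₀ hq, zpow_natCast]
  have hkj : q ^ ((k : ℤ) + j - n) = q ^ k * q ^ j * q ^ (-(n : ℤ)) := by
    rw [sub_eq_add_neg, zpow_add₀ hq, zpow_add₀ hq, zpow_natCast, zpow_natCast]
  simp only [moment]
  rw [hab, hbc, h1, h2, h.inv_abcd_eq ((k : ℤ) + j - n), hk, hj, hkj, ← add_assoc,
    add_right_comm k 1 j, qPoch_succ, qPoch_succ, qPoch_succ, pow_add]
  generalize q ^ (-(n : ℤ)) = B
  have hk0 : q ^ k ≠ 0 := pow_ne_zero _ hq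
  generalize (qPochInt q (a * b * c * d) ((k : ℤ) + j - n + 1))⁻¹ = G
  generalize qPochInt q (a * b) ((k : ℤ) - n) = F₁
  generalize qPochInt q (b * c) ((j : ℤ) - n) = F₂
  generalize qPochInt q (b * d) (-(n : ℤ)) = F₃
  field_simp
  ring

/-- The analogue with `B = b q^{-1-n}`, the factor of `d_{n+1}` that cancels: it expresses
compatibility of levels `n` and `n + 1`. -/
theorem moment_zero_eq (h : Admissible q a b c d) (k n : ℕ) :
    moment q a b c d 0 k n
      = b * q ^ (-1 - (n : ℤ)) / (a * q ^ k) * moment q a b c d 0 (k + 1) (n + 1) +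
        (1 - b * q ^ (-1 - (n : ℤ)) / (a * q ^ k)) *
          (1 - a * q ^ k * (b * q ^ (-1 - (n : ℤ)))) * moment q a b c d 0 k (n + 1) := by
  have hq := h.q_ne
  have ha := h.a_ne
  have hk : q ^ ((k : ℤ) - (n + 1 : ℕ)) = q ^ k * q ^ (-1 - (n : ℤ)) := by
    rw [← zpow_natCast q k, ← zpow_add₀ hq]
    congr 1
    push_cast
    ring
  have h0 : q ^ (-((n + 1 : ℕ) : ℤ)) = q ^ (-1 - (n : ℤ)) := by
    congr 1
    push_cast
    ring
  have hab : qPochInt q (a * b) ((k : ℤ) - n) = (1 - a * b * (q ^ k * q ^ (-1 - (n : ℤ)))) *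
      qPochInt q (a * b) ((k : ℤ) - (n + 1 : ℕ)) := by
    rw [← hk, ← qPochInt_add_one hq (h.ab_ne _)]
    congr 1
    push_cast
    ring
  have hbc : qPochInt q (b * c) (-(n : ℤ)) = (1 - b * c * q ^ (-1 - (n : ℤ))) *
      qPochInt q (b * c) (-((n + 1 : ℕ) : ℤ)) := by
    rw [← h0, ← qPochInt_add_one hq (h.bc_ne _)]
    congr 1
    push_cast
    ring
  have hbd : qPochInt q (b * d) (-(n : ℤ)) = (1 - b * d * q ^ (-1 - (n : ℤ))) *
      qPochInt q (b * d) (-((n + 1 : ℕ) : ℤ)) := by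
    rw [← h0, ← qPochInt_add_one hq (h.bd_ne _)]
    congr 1
    push_cast
    ring
  have hG : (qPochInt q (a * b * c * d) ((k : ℤ) - (n + 1 : ℕ)))⁻¹
      = (1 - a * b * c * d * (q ^ k * q ^ (-1 - (n : ℤ)))) *
        (qPochInt q (a * b * c * d) ((k : ℤ) - n))⁻¹ := by
    rw [h.inv_abcd_eq, hk]
    congr 3
    push_cast
    ring
  have h1 : ((k + 1 : ℕ) : ℤ) - (n + 1 : ℕ) = (k : ℤ) - n := by push_cast; ring
  simp only [moment, Nat.cast_zero, zero_sub, add_zero, h1]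
  rw [hG, hab, hbc, hbd, qPoch_succ, qPoch_succ]
  generalize q ^ (-1 - (n : ℤ)) = B
  have hk0 : q ^ k ≠ 0 := pow_ne_zero _ hq
  generalize (qPochInt q (a * b * c * d) ((k : ℤ) - n))⁻¹ = G
  generalize qPochInt q (a * b) ((k : ℤ) - (n + 1 : ℕ)) = F₁
  generalize qPochInt q (b * c) (-((n + 1 : ℕ) : ℤ)) = F₂
  generalize qPochInt q (b * d) (-((n + 1 : ℕ) : ℤ)) = F₃
  field_simp
  ring

theorem pairFactor_den_ne_zero (h : Admissible q a b c d)
    (n : ℕ) : pairFactor (b * q ^ (-1 - (n : ℤ))) ≠ 0 := by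
  intro h0
  have := degree_pairFactor h.two_ne (mul_ne_zero h.b_ne (zpow_ne_zero (-1 - (n : ℤ)) h.q_ne))
  simp [h0] at this

theorem den_ne_zero (h : Admissible q a b c d) (n : ℕ) : den q b n ≠ 0 := by
  rw [den_eq_prod]
  exact Finset.prod_ne_zero_iff.mpr fun j _ => h.pairFactor_den_ne_zero j

theorem exists_isAskeyWilsonFunctional (h : Admissible q a b c d) :
    ∃ L : ratSpace (den q b) →ₗ[K] K, IsAskeyWilsonFunctional q a b c d L := by
  have ha (k : ℕ) : a * q ^ k ≠ 0 := mul_ne_zero h.a_ne (pow_ne_zero k h.q_ne)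
  let B := pairBasis h.two_ne h.q_ne h.a_ne
  have hB (k : ℕ) : B k = pairPoch q a k := pairBasis_apply _ _ _ k
  let Λ : ℕ → K[X] →ₗ[K] K := fun n => B.constr K fun k => moment q a b c d 0 k n
  have hΛ (n k : ℕ) : Λ n (pairPoch q a k) = moment q a b c d 0 k n := by
    rw [← hB]
    exact B.constr_basis _ _ _
  have hcompat (n : ℕ) (p : K[X]) :
      Λ (n + 1) (p * pairFactor (b * q ^ (-1 - (n : ℤ)))) = Λ n p := by
    have : (Λ (n + 1)).comp (LinearMap.mulRight K (pairFactor (b * q ^ (-1 - (n : ℤ))))) = Λ n := by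
      refine B.ext fun k => ?_
      rw [hB, LinearMap.comp_apply, LinearMap.mulRight_apply, pairFactor_eq (ha k), mul_add,
        map_add, mul_left_comm, ← pairPoch_succ, mul_comm (pairPoch q a k) (C _),
        BiorthogonalData.map_C_mul, BiorthogonalData.map_C_mul, hΛ, hΛ, hΛ, h.moment_zero_eq k n]
    exact LinearMap.congr_fun this p
  have hj (n j k : ℕ) : Λ n (pairPoch q c j * pairPoch q a k) = moment q a b c d j k n := by
    induction j generalizing k with
    | zero => rw [show pairPoch q c 0 = 1 by simp [pairPoch], one_mul, hΛ]
    | succ j ih =>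
      have : pairPoch q c (j + 1) * pairPoch q a k
          = C (c * q ^ j / (a * q ^ k)) * (pairPoch q c j * pairPoch q a (k + 1)) +
            C ((1 - c * q ^ j / (a * q ^ k)) * (1 - a * q ^ k * (c * q ^ j))) *
              (pairPoch q c j * pairPoch q a k) := by
        rw [pairPoch_succ q c, pairPoch_succ q a, pairFactor_eq (ha k) (c * q ^ j)]
        ring
      rw [this, map_add, BiorthogonalData.map_C_mul, BiorthogonalData.map_C_mul, ih, ih,
        h.moment_succ_left]
  obtain ⟨L, hL⟩ := exists_functional h.pairFactor_den_ne_zero h.den_ne_zero (den_succ q b) Λ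
    hcompat
  exact ⟨L, (isAskeyWilsonFunctional_iff h.q_ne a b c d L).mpr fun j k n => by rw [hL, hj]⟩

theorem apply_frac_pairPoch (hq : q ≠ 0) {L : ratSpace (den q b) →ₗ[K] K}
    (hL : IsAskeyWilsonFunctional q a b c d L) (k n : ℕ) :
    L (frac (den q b) (pairPoch q a k) n) = moment q a b c d 0 k n := by
  have := (isAskeyWilsonFunctional_iff hq a b c d L).mp hL 0 k n
  rwa [show pairPoch q c 0 = 1 by simp [pairPoch], one_mul] at this

/-- The values with `j = 0` suffice, since the numerators `(az, a/z; q)_k` form a basis at every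
level. -/
theorem isAskeyWilsonFunctional_unique (h : Admissible q a b c d)
    {L L' : ratSpace (den q b) →ₗ[K] K}
    (hL : IsAskeyWilsonFunctional q a b c d L) (hL' : IsAskeyWilsonFunctional q a b c d L') :
    L = L' := by
  have key (m : ℕ) : L.comp (fracMap (den q b) m) = L'.comp (fracMap (den q b) m) := by
    refine (pairBasis h.two_ne h.q_ne h.a_ne).ext fun k => ?_
    rw [pairBasis_apply, LinearMap.comp_apply, LinearMap.comp_apply, fracMap_apply,
      apply_frac_pairPoch h.q_ne hL, apply_frac_pairPoch h.q_ne hL']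
  refine LinearMap.ext fun v => ?_
  obtain ⟨p, m, rfl⟩ := exists_eq_frac h.pairFactor_den_ne_zero (den_succ q b) v
  exact LinearMap.congr_fun (key m) p

end Admissible

/-! ### Type `R_I` sequences from biorthogonality -/

theorem IsTypeRI.monic {d : ℕ → K[X]} {L : ratSpace d →ₗ[K] K} {P : ℕ → K[X]}
    (hP : IsTypeRI d L P) (n : ℕ) : (P n).Monic ∧ (P n).degree = n := by
  obtain ⟨⟨β, α, γ, h0, h1, hrec, -, -⟩, -⟩ := hP
  induction n using Nat.strong_induction_on with
  | _ n ih =>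
    match n with
    | 0 => simp [h0]
    | 1 => exact ⟨h1 ▸ monic_X_sub_C _, h1 ▸ degree_X_sub_C _⟩
    | n + 2 =>
      have hr := hrec (n + 1) (by omega)
      rw [Nat.add_sub_cancel] at hr
      obtain ⟨hm1, hd1⟩ := ih (n + 1) (by omega)
      obtain ⟨-, hd0⟩ := ih n (by omega)
      have hd : ((X - C (β (n + 1))) * P (n + 1)).degree = ((n + 2 : ℕ) : WithBot ℕ) := by
        rw [degree_mul, degree_X_sub_C, hd1]
        norm_cast
        ring
      have hlt : ((C (α (n + 1)) * X + C (γ (n + 1))) * P n).degree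
          < ((X - C (β (n + 1))) * P (n + 1)).degree := by
        rw [hd, degree_mul, hd0]
        calc _ ≤ (1 : WithBot ℕ) + n := by gcongr; exact degree_linear_le
          _ < _ := by norm_cast; omega
      rw [show n + 2 = n + 1 + 1 from rfl, hr]
      exact ⟨((monic_X_sub_C _).mul hm1).sub_of_left hlt,
        (degree_sub_eq_left_of_degree_lt hlt).trans hd⟩

theorem BiorthogonalData.isTypeRI_iff {d e p : ℕ → K[X]} {L : ratSpace d →ₗ[K] K}
    (h : BiorthogonalData (fun m => L.comp (fracMap d m)) e p)
    (hd : ∀ m, d m = ∏ j ∈ Finset.range m, e j) (hL : L (frac d (d 0) 0) = 1) (P : ℕ → K[X]) :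
    IsTypeRI d L P ↔ ∀ n, P n = C (p n).leadingCoeff⁻¹ * p n := by
  constructor
  · intro hP n
    obtain ⟨hm, hdeg⟩ := hP.monic n
    obtain ⟨t, ht⟩ := (h.orthogonal_iff hdeg.le).mp fun k hk => hP.2.2 k n hk
    have hlc := congrArg leadingCoeff ht
    rw [hm.leadingCoeff, leadingCoeff_mul, leadingCoeff_C] at hlc
    rw [ht, eq_inv_of_mul_eq_one_left hlc.symm]
  · intro hP
    have h' := h.monic_normalize
    rw [← funext hP] at h'
    have hmon (n : ℕ) : (P n).Monic := by
      rw [hP, mul_comm]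
      exact monic_mul_leadingCoeff_inv (h.p_ne_zero n)
    choose β l hl hrec using h'.exists_recurrence hmon
    have he (n : ℕ) : e n = C ((e n).coeff 1) * X + C ((e n).coeff 0) :=
      eq_X_add_C_of_degree_le_one (h.degree_e n).le
    have he1 (n : ℕ) : (e n).coeff 1 ≠ 0 := coeff_ne_zero_of_eq_degree (h.degree_e n)
    have hlin (n : ℕ) : C (l n * (e n).coeff 1) * X + C (l n * (e n).coeff 0) = C (l n) * e n := by
      conv_rhs => rw [he n]
      simp only [map_mul]
      ring
    -- The linear factor with index `n + 1` is `l n * e n`; the entries of `α` and `γ` at `0` are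
    -- never used, and `β 0` is read off from `P 1`.
    refine ⟨⟨fun n => n.casesOn (-(P 1).coeff 0) β,
      fun n => n.casesOn 0 fun n => l n * (e n).coeff 1,
      fun n => n.casesOn 0 fun n => l n * (e n).coeff 0, ?_, ?_, ?_, ?_, ?_⟩, hL, ?_⟩
    · exact (hmon 0).natDegree_eq_zero.mp (natDegree_eq_of_degree_eq_some (h'.degree_p 0))
    · have h1 := eq_X_add_C_of_degree_le_one (h'.degree_p 1).le
      have h2 := (hmon 1).coeff_natDegree
      rw [natDegree_eq_of_degree_eq_some (h'.degree_p 1)] at h2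
      conv_lhs => rw [h1, h2]
      simp
    · intro n hn
      obtain ⟨n, rfl⟩ := Nat.exists_eq_add_of_le' hn
      simp only [Nat.add_sub_cancel, hlin]
      exact hrec n
    · intro n hn
      obtain ⟨n, rfl⟩ := Nat.exists_eq_add_of_le' hn
      refine ⟨mul_ne_zero (hl n) (he1 n), h'.eval_ne_zero n ?_⟩
      have := he1 n
      have := hl n
      rw [he n]
      simp only [eval_add, eval_mul, eval_C, eval_X]
      field_simp
      ring
    · intro m
      refine ⟨∏ i ∈ Finset.range m, l i, Finset.prod_ne_zero_iff.mpr fun i _ => hl i, ?_⟩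
      rw [hd, map_prod, ← Finset.prod_mul_distrib]
      induction m with
      | zero => simp
      | succ m ih =>
        rw [Finset.prod_Icc_succ_top (by omega), ih, Finset.prod_range_succ]
        congr 1
        exact hlin m
    · intro n m hnm
      exact h'.map_mul_eq_zero le_rfl (by rw [degree_X_pow]; exact_mod_cast hnm)

/-! ### Biorthogonality of the shifted Askey–Wilson polynomials -/

/-- The shift `b → b q^{-n}` cancels the `q^n` in the parameter `abcd q^{n-1}`, which becomes
independent of `n`. -/
theorem askeyWilson_shift {q : K} (hq : q ≠ 0) (a b c d : K) (n : ℕ) :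
    askeyWilson q a (b * q ^ (-(n : ℤ))) c d n =
      C (qPoch q (a * b * q ^ (-(n : ℤ))) n * qPoch q (a * c) n * qPoch q (a * d) n / a ^ n) *
        phi43 q n (a * b * c * d / q) a (a * c) (a * d) (a * b * q ^ (-(n : ℤ))) := by
  have h1 : a * (b * q ^ (-(n : ℤ))) * c * d * q ^ ((n : ℤ) - 1) = a * b * c * d / q := by
    have : q ^ (-(n : ℤ)) * q ^ ((n : ℤ) - 1) = q⁻¹ := by
      rw [← zpow_add₀ hq, ← zpow_neg_one]
      congr 1
      ring
    rw [div_eq_mul_inv, ← this]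
    ring
  rw [askeyWilson, h1, ← mul_assoc a b]
  congr 1
  refine Finset.sum_congr rfl fun k _ => ?_
  congr 4
  ring

namespace Admissible

variable {q a b c d : K}

theorem qPoch_ab_ne_zero (h : Admissible q a b c d)
    {n k : ℕ} (hk : k ≤ n) : qPoch q (a * b * q ^ (-(n : ℤ))) k ≠ 0 :=
  qPoch_ne_zero fun i hi => by
    rw [mul_assoc, ← zpow_natCast q i, ← zpow_add₀ h.q_ne]
    exact h.ab_ne _ (by omega)

theorem prefactor_ne_zero (h : Admissible q a b c d) (n : ℕ) :
    qPoch q (a * b * q ^ (-(n : ℤ))) n * qPoch q (a * c) n * qPoch q (a * d) n / a ^ n ≠ 0 :=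
  div_ne_zero (mul_ne_zero (mul_ne_zero (h.qPoch_ab_ne_zero le_rfl)
    (qPoch_ne_zero fun i _ => h.ac_ne i)) (qPoch_ne_zero fun i _ => h.ad_ne i))
    (pow_ne_zero _ h.a_ne)

theorem degree_sum_pairPoch (h2 : (2 : K) ≠ 0) (hq : q ≠ 0) (ha : a ≠ 0) {n : ℕ} {t : ℕ → K}
    (ht : t n ≠ 0) : (∑ k ∈ Finset.range (n + 1), C (t k) * pairPoch q a k).degree = n := by
  have hp (k : ℕ) := degree_pairPoch h2 hq ha k
  have hn : (C (t n) * pairPoch q a n).degree = n := by rw [degree_C_mul ht, hp]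
  rw [Finset.sum_range_succ, degree_add_eq_right_of_degree_lt, hn]
  rw [hn]
  refine (degree_sum_le _ _).trans_lt ((Finset.sup_lt_iff (WithBot.bot_lt_coe n)).mpr ?_)
  intro k hk
  rw [← smul_eq_C_mul]
  refine (degree_smul_le _ _).trans_lt ?_
  rw [hp]
  exact WithBot.coe_lt_coe.mpr (Finset.mem_range.mp hk)

theorem degree_askeyWilson (h : Admissible q a b c d)
    (n : ℕ) : (askeyWilson q a (b * q ^ (-(n : ℤ))) c d n).degree = n := by
  rw [askeyWilson_shift h.q_ne, degree_C_mul (h.prefactor_ne_zero n), phi43]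
  refine degree_sum_pairPoch h.two_ne h.q_ne h.a_ne ?_
  refine mul_ne_zero (div_ne_zero (mul_ne_zero ?_ ?_) (mul_ne_zero (mul_ne_zero (mul_ne_zero
    (qPoch_ne_zero fun i _ => h.ac_ne i) (qPoch_ne_zero fun i _ => h.ad_ne i))
    (h.qPoch_ab_ne_zero le_rfl)) (qPoch_self_ne_zero h.q_pow_ne n))) (pow_ne_zero _ h.q_ne)
  · refine qPoch_ne_zero fun i hi h1 => h.q_pow_ne (n - i) (by omega) ?_
    rw [← zpow_natCast, ← zpow_add₀ h.q_ne] at h1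
    rw [← zpow_natCast, Nat.cast_sub hi.le, ← neg_sub, zpow_neg, sub_eq_neg_add, h1, inv_one]
  · refine qPoch_ne_zero fun i _ => ?_
    rw [div_eq_mul_inv, ← zpow_neg_one, mul_assoc, ← zpow_natCast, ← zpow_add₀ h.q_ne]
    exact h.abcd_ne _ (by omega)

/-- The functional at `p_n / d_m`, as a multiple of a terminating basic hypergeometric sum. -/
theorem exists_apply_askeyWilson_eq (h : Admissible q a b c d) {L : ratSpace (den q b) →ₗ[K] K}
    (hL : IsAskeyWilsonFunctional q a b c d L) (n m : ℕ) (R : ℕ → K)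
    (hR : ∀ k ≤ n, qPoch q (a * b * c * d / q) k *
        (qPochInt q (a * b * c * d) ((k : ℤ) - m))⁻¹ * qPochInt q (a * b) ((k : ℤ) - m)
      = (qPochInt q (a * b * c * d) (-1))⁻¹ * qPochInt q (a * b) (-(n : ℤ)) *
        qPoch q (a * b * q ^ (-(n : ℤ))) k * R k) :
    ∃ ρ : K, ρ ≠ 0 ∧ L (frac (den q b) (askeyWilson q a (b * q ^ (-(n : ℤ))) c d n) m) =
      ρ * ∑ k ∈ Finset.range (n + 1), hypWeight q n k * R k := by
  -- The witness collects the prefactor of the polynomial and the parts of the moments that do not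
  -- depend on `k`.
  refine ⟨qPoch q (a * b * q ^ (-(n : ℤ))) n * qPoch q (a * c) n * qPoch q (a * d) n / a ^ n *
    (qPochInt q (b * c) (-(m : ℤ)) * qPochInt q (b * d) (-(m : ℤ)) *
      ((qPochInt q (a * b * c * d) (-1))⁻¹ * qPochInt q (a * b) (-(n : ℤ)))), ?_, ?_⟩
  · refine mul_ne_zero (h.prefactor_ne_zero n) (mul_ne_zero (mul_ne_zero ?_ ?_)
      (mul_ne_zero (inv_ne_zero ?_) ?_))
    · exact qPochInt_ne_zero (fun i _ _ => by omega) (fun i hi _ => h.bc_ne i hi) h.q_ne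
    · exact qPochInt_ne_zero (fun i _ _ => by omega) (fun i hi _ => h.bd_ne i hi) h.q_ne
    · exact qPochInt_ne_zero (fun i _ _ => by omega) (fun i _ hi => h.abcd_ne i hi) h.q_ne
    · exact qPochInt_ne_zero (fun i _ _ => by omega) (fun i hi _ => h.ab_ne i hi) h.q_ne
  · rw [askeyWilson_shift h.q_ne, ← fracMap_apply, ← LinearMap.comp_apply,
      BiorthogonalData.map_C_mul, mul_assoc (_ / _)]
    congr 1
    rw [phi43, map_sum, Finset.mul_sum]
    refine Finset.sum_congr rfl fun k hk => ?_
    have hk' : k ≤ n := Nat.lt_succ_iff.mp (Finset.mem_range.mp hk)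
    rw [BiorthogonalData.map_C_mul, LinearMap.comp_apply, fracMap_apply,
      apply_frac_pairPoch h.q_ne hL]
    have h0 : qPoch q (c * d) 0 = 1 := by simp [qPoch]
    have h1 := h.qPoch_ab_ne_zero hk'
    have h2 : qPoch q (a * c) k ≠ 0 := qPoch_ne_zero fun i _ => h.ac_ne i
    have h3 : qPoch q (a * d) k ≠ 0 := qPoch_ne_zero fun i _ => h.ad_ne i
    have h4 := qPoch_self_ne_zero h.q_pow_ne k
    have hRk := hR k hk'
    simp only [moment, hypWeight, h0, Nat.cast_zero, zero_sub, add_zero]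
    generalize (qPochInt q (a * b * c * d) (-1))⁻¹ = G₁ at *
    generalize (qPochInt q (a * b * c * d) ((k : ℤ) - m))⁻¹ = G at *
    generalize qPoch q (a * b * q ^ (-(n : ℤ))) k = D at *
    field_simp
    linear_combination qPoch q (q ^ (-(n : ℤ))) k * q ^ k *
      qPochInt q (b * c) (-(m : ℤ)) * qPochInt q (b * d) (-(m : ℤ)) * hRk

theorem abcd_natCast_ne (h : Admissible q a b c d) (i : ℕ) : a * b * c * d * q ^ i ≠ 1 := by
  have := h.abcd_ne i (by omega)
  rwa [zpow_natCast] at this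

/-- The series parameter `abcd / q` cancels the `abcd` part of the moment exactly at level `1`;
likewise, by `qPoch_ab_mul`, `ab q^{-n}` cancels the `ab` part at level `n`. Between these levels
only polynomial factors in `q^k` remain. -/
theorem qPoch_abcd_mul_inv (h : Admissible q a b c d) (k : ℕ) :
    qPoch q (a * b * c * d / q) k * (qPochInt q (a * b * c * d) ((k : ℤ) - 1))⁻¹
      = (qPochInt q (a * b * c * d) (-1))⁻¹ := by
  rw [inv_qPochInt_eq_natCast h.q_ne (N := -1) k h.abcd_natCast_ne, zpow_neg_one,
    ← div_eq_mul_inv (a * b * c * d), neg_add_eq_sub]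

theorem qPoch_ab_mul (h : Admissible q a b c d) (n k : ℕ) :
    qPochInt q (a * b) ((k : ℤ) - n)
      = qPoch q (a * b * q ^ (-(n : ℤ))) k * qPochInt q (a * b) (-(n : ℤ)) := by
  rw [← qPochInt_add_natCast h.q_ne k h.ab_ne, neg_add_eq_sub]

theorem biorthogonalData (h : Admissible q a b c d) {L : ratSpace (den q b) →ₗ[K] K}
    (hL : IsAskeyWilsonFunctional q a b c d L) :
    BiorthogonalData (fun m => L.comp (fracMap (den q b) m))
      (fun n => pairFactor (b * q ^ (-1 - (n : ℤ))))
      fun n => askeyWilson q a (b * q ^ (-(n : ℤ))) c d n := by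
  have hq := h.q_ne
  have hz (A : K) (k n : ℕ) : A * q ^ ((k : ℤ) - n) = A * q ^ (-(n : ℤ)) * q ^ k := by
    rw [mul_assoc, ← zpow_natCast q k, ← zpow_add₀ hq, neg_add_eq_sub]
  refine ⟨fun n => ?_, h.degree_askeyWilson, fun n f => ?_, fun n m hm hmn => ?_, fun n => ?_,
    fun n => ?_⟩
  · exact degree_pairFactor h.two_ne (mul_ne_zero h.b_ne (zpow_ne_zero _ hq))
  · exact congrArg L (frac_mul_mul (h.pairFactor_den_ne_zero n) (den_succ q b n) f)
  -- The summand has degree at most `(m - 1) + (n - m) = n - 1` in `q^k`.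
  · obtain ⟨ρ, -, h1⟩ := h.exists_apply_askeyWilson_eq hL n m
      (fun k => qPoch q (a * b * c * d * q ^ (-(m : ℤ)) * q ^ k) (m - 1) *
        qPoch q (a * b * q ^ (-(n : ℤ)) * q ^ k) (n - m)) fun k _ => by
        have e1 : (qPochInt q (a * b * c * d) ((k : ℤ) - m))⁻¹
            = qPoch q (a * b * c * d * q ^ ((k : ℤ) - m)) (m - 1) *
              (qPochInt q (a * b * c * d) ((k : ℤ) - 1))⁻¹ := by
          rw [inv_qPochInt_eq_natCast hq (m - 1) h.abcd_natCast_ne]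
          congr 3
          omega
        have e2 : qPochInt q (a * b) ((k : ℤ) - m)
            = qPoch q (a * b * q ^ ((k : ℤ) - n)) (n - m) * qPochInt q (a * b) ((k : ℤ) - n) := by
          rw [← qPochInt_add_natCast hq _ h.ab_ne]
          congr 1
          omega
        rw [e1, e2, h.qPoch_ab_mul, ← h.qPoch_abcd_mul_inv k, hz, hz]
        ring
    refine h1.trans ?_
    rw [sum_hypWeight_mul_qPoch_eq_zero hq h.q_pow_ne (by omega), mul_zero]
  · have hne (k : ℕ) : a * b * c * d * q ^ (-1 : ℤ) * q ^ k ≠ 1 := by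
      rw [mul_assoc, ← zpow_natCast q k, ← zpow_add₀ hq]
      exact h.abcd_ne _ (by omega)
    obtain ⟨ρ, hρ, h1⟩ := h.exists_apply_askeyWilson_eq hL n 0
      (fun k => qPoch q (a * b * q ^ (-(n : ℤ)) * q ^ k) n /
        (1 - a * b * c * d * q ^ (-1 : ℤ) * q ^ k)) fun k _ => by
        have hk : 1 - a * b * c * d * q ^ (-1 : ℤ) * q ^ k ≠ 0 := sub_ne_zero.mpr (hne k).symm
        have e1 : (qPochInt q (a * b * c * d) ((k : ℤ) - 1))⁻¹
            = (1 - a * b * c * d * q ^ (-1 : ℤ) * q ^ k) *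
              (qPochInt q (a * b * c * d) ((k : ℤ) - (0 : ℕ)))⁻¹ := by
          rw [h.inv_abcd_eq, sub_add_cancel, Nat.cast_zero, sub_zero,
            sub_eq_neg_add (k : ℤ), zpow_add₀ hq, zpow_natCast, mul_assoc _ _ (q ^ k)]
        have e2 : qPochInt q (a * b) ((k : ℤ) - (0 : ℕ))
            = qPoch q (a * b * q ^ ((k : ℤ) - n)) n * qPochInt q (a * b) ((k : ℤ) - n) := by
          rw [← qPochInt_add_natCast hq _ h.ab_ne]
          congr 1
          simp
        rw [← h.qPoch_abcd_mul_inv k, e1, e2, h.qPoch_ab_mul, hz]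
        generalize (qPochInt q (a * b * c * d) ((k : ℤ) - (0 : ℕ)))⁻¹ = G
        generalize 1 - a * b * c * d * q ^ (-1 : ℤ) * q ^ k = D at *
        field_simp
    -- At level `0` the excluded coincidence is `ab q^{i-n} = abcd / q`, that is, `cd q^{n-1-i} =
    -- 1`.
    refine h1.trans_ne (mul_ne_zero hρ (sum_hypWeight_mul_qPoch_div_ne_zero hq h.q_pow_ne
      (fun k _ => hne k) fun i hi heq => h.cd_ne (n - 1 - i) ?_))
    have hab : a * b * q ^ (-1 : ℤ) ≠ 0 :=
      mul_ne_zero (mul_ne_zero h.a_ne h.b_ne) (zpow_ne_zero _ hq)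
    have e1 : q ^ (-(n : ℤ)) * q ^ i * q ^ (n - 1 - i) = q ^ (-1 : ℤ) := by
      rw [← zpow_natCast q i, ← zpow_natCast q (n - 1 - i), ← zpow_add₀ hq, ← zpow_add₀ hq]
      congr 1
      omega
    refine mul_left_cancel₀ hab ?_
    linear_combination (-q ^ (n - 1 - i)) * heq + a * b * e1
  · have hne (k : ℕ) (hk : k ≤ n) : a * b * q ^ (-((n + 1 : ℕ) : ℤ)) * q ^ k ≠ 1 := by
      rw [mul_assoc, ← zpow_natCast q k, ← zpow_add₀ hq]
      exact h.ab_ne _ (by omega)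
    obtain ⟨ρ, hρ, h1⟩ := h.exists_apply_askeyWilson_eq hL n (n + 1)
      (fun k => qPoch q (a * b * c * d * q ^ (-((n + 1 : ℕ) : ℤ)) * q ^ k) n /
        (1 - a * b * q ^ (-((n + 1 : ℕ) : ℤ)) * q ^ k)) fun k hk' => by
        have hk : 1 - a * b * q ^ (-((n + 1 : ℕ) : ℤ)) * q ^ k ≠ 0 :=
          sub_ne_zero.mpr (hne k hk').symm
        have e1 : (qPochInt q (a * b * c * d) ((k : ℤ) - (n + 1 : ℕ)))⁻¹
            = qPoch q (a * b * c * d * q ^ ((k : ℤ) - (n + 1 : ℕ))) n *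
              (qPochInt q (a * b * c * d) ((k : ℤ) - 1))⁻¹ := by
          rw [inv_qPochInt_eq_natCast hq n h.abcd_natCast_ne]
          congr 3
          push_cast
          ring
        have e2 : qPochInt q (a * b) ((k : ℤ) - n)
            = (1 - a * b * q ^ (-((n + 1 : ℕ) : ℤ)) * q ^ k) *
              qPochInt q (a * b) ((k : ℤ) - (n + 1 : ℕ)) := by
          rw [← hz, ← qPochInt_add_one hq (h.ab_ne _)]
          congr 1
          push_cast
          ring
        have e3 := e2.symm.trans (h.qPoch_ab_mul n k)
        rw [← h.qPoch_abcd_mul_inv k, e1, hz]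
        generalize (qPochInt q (a * b * c * d) ((k : ℤ) - 1))⁻¹ = G
        generalize 1 - a * b * q ^ (-((n + 1 : ℕ) : ℤ)) * q ^ k = D at *
        field_simp
        linear_combination qPoch q (a * b * c * d / q) k * G *
          qPoch q (a * b * c * d * q ^ (-((n + 1 : ℕ) : ℤ)) * q ^ k) n * e3
    -- At level `n + 1`, numerator and pole parameters have ratio `cd`, so the coincidence is `cd
    -- q^i = 1`.
    refine h1.trans_ne (mul_ne_zero hρ (sum_hypWeight_mul_qPoch_div_ne_zero hq h.q_pow_ne hne
      fun i _ heq => h.cd_ne i ?_))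
    have hab : a * b * q ^ (-((n + 1 : ℕ) : ℤ)) ≠ 0 :=
      mul_ne_zero (mul_ne_zero h.a_ne h.b_ne) (zpow_ne_zero _ hq)
    refine mul_left_cancel₀ hab ?_
    linear_combination heq

theorem apply_one (h : Admissible q a b c d)
    {L : ratSpace (den q b) →ₗ[K] K} (hL : IsAskeyWilsonFunctional q a b c d L) :
    L (frac (den q b) (den q b 0) 0) = 1 := by
  have h1 := apply_frac_pairPoch h.q_ne hL 0 0
  have h0 (A : K) : qPochInt q A 0 = 1 := by
    rw [← Nat.cast_zero, qPochInt_natCast]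
    simp [qPoch]
  simpa [den, pairPoch, moment, qPoch, h0] using h1

end Admissible

end AskeyWilsonRI

end

/-! ### The main theorem -/

theorem mainTheorem12 {K : Type*} [Field K] (h2 : (2 : K) ≠ 0)
    (q a b c d : K) (hq0 : q ≠ 0) (hq : ∀ m : ℕ, 1 ≤ m → q ^ m ≠ 1)
    (ha : a ≠ 0) (hb : b ≠ 0)
    (hac : ∀ i : ℕ, a * c * q ^ i ≠ 1)
    (had : ∀ i : ℕ, a * d * q ^ i ≠ 1)
    (hcd : ∀ i : ℕ, c * d * q ^ i ≠ 1)
    (hab : ∀ i : ℕ, 1 ≤ i → a * b ≠ q ^ i)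
    (hbc : ∀ i : ℕ, 1 ≤ i → b * c ≠ q ^ i)
    (hbd : ∀ i : ℕ, 1 ≤ i → b * d ≠ q ^ i)
    (habcd : ∀ i : ℕ, a * b * c * d * q ^ i ≠ q) :
    -- the functional exists and is unique
    (∃! L : AskeyWilsonRI.ratSpace (AskeyWilsonRI.den q b) →ₗ[K] K,
      AskeyWilsonRI.IsAskeyWilsonFunctional q a b c d L) ∧
    -- the shifted polynomial has degree `n` and is given by the displayed series
    (∀ n : ℕ,
      (AskeyWilsonRI.askeyWilson q a (b * q ^ (-(n : ℤ))) c d n).degree = n ∧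
      AskeyWilsonRI.askeyWilson q a (b * q ^ (-(n : ℤ))) c d n =
        Polynomial.C (AskeyWilsonRI.qPoch q (a * b * q ^ (-(n : ℤ))) n *
          AskeyWilsonRI.qPoch q (a * c) n * AskeyWilsonRI.qPoch q (a * d) n / a ^ n) *
        AskeyWilsonRI.phi43 q n (a * b * c * d / q) a (a * c) (a * d)
          (a * b * q ^ (-(n : ℤ)))) ∧
    ∀ L : AskeyWilsonRI.ratSpace (AskeyWilsonRI.den q b) →ₗ[K] K,
      AskeyWilsonRI.IsAskeyWilsonFunctional q a b c d L →
      -- type `R_I` orthogonality for fixed `n` characterizes it up to a constant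
      (∀ (n : ℕ) (p : Polynomial K), p.degree ≤ n →
        ((∀ k : ℕ, k < n →
            L (AskeyWilsonRI.frac (AskeyWilsonRI.den q b) (Polynomial.X ^ k * p) n) = 0) ↔
          ∃ t : K, p = Polynomial.C t *
            AskeyWilsonRI.askeyWilson q a (b * q ^ (-(n : ℤ))) c d n)) ∧
      -- the monic type `R_I` polynomials are exactly the normalized shifted polynomials
      ∀ P : ℕ → Polynomial K,
        AskeyWilsonRI.IsTypeRI (AskeyWilsonRI.den q b) L P ↔
          ∀ n : ℕ, P n =
            Polynomial.C
              (AskeyWilsonRI.askeyWilson q a (b * q ^ (-(n : ℤ))) c d n).leadingCoeff⁻¹ *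
            AskeyWilsonRI.askeyWilson q a (b * q ^ (-(n : ℤ))) c d n := by
  have hq1 (A : K) (hA : ∀ i : ℕ, 1 ≤ i → A ≠ q ^ i) (M : ℤ) (hM : M < 0) : A * q ^ M ≠ 1 := by
    intro h
    refine hA M.natAbs (by omega) ?_
    rw [← zpow_natCast, show (M.natAbs : ℤ) = -M by omega, zpow_neg]
    exact eq_inv_of_mul_eq_one_left h
  have h : AskeyWilsonRI.Admissible q a b c d :=
    ⟨h2, hq0, hq, ha, hb, hac, had, hcd, hq1 _ hab, hq1 _ hbc, hq1 _ hbd, fun M hM h1 => by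
      refine habcd (M + 1).toNat ?_
      rw [← zpow_natCast, Int.toNat_of_nonneg (by omega), zpow_add_one₀ hq0, ← mul_assoc, h1,
        one_mul]⟩
  refine ⟨?_, fun n => ⟨h.degree_askeyWilson n, AskeyWilsonRI.askeyWilson_shift hq0 a b c d n⟩,
    fun L hL => ⟨fun n p hp => (h.biorthogonalData hL).orthogonal_iff hp, fun P =>
      (h.biorthogonalData hL).isTypeRI_iff (AskeyWilsonRI.den_eq_prod q b) (h.apply_one hL) P⟩⟩
  obtain ⟨L, hL⟩ := h.exists_isAskeyWilsonFunctional
  exact ⟨L, hL, fun L' hL' => h.isAskeyWilsonFunctional_unique hL' hL⟩
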